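/- Let $\Omega\subset\mathbb R^2$ be a bounded Lipschitz polygonal domain, let $\Gamma$ be a curve embedded in $\Omega$ (a finite union of regular simple $C^1$ arcs which run in $\Omega$, except that end points may lie on $\partial\Omega$, and which meet in end points only) with unit normal $\hat n$, and let $\epsilon_0,\mu_0,\tau_0,\sigma_0,T>0$. Write $a\times b=a_xb_y-a_yb_x$, $\nabla\times\psi=(\partial_y\psi,-\partial_x\psi)'$, $\nabla\times u=\partial_xu_y-\partial_yu_x$; let $(\cdot,\cdot)$, $\|\cdot\|$ be the inner product and norm of $L^2(\Omega)$, and put $\langle u,v\rangle_\Gamma=\int_\Gamma(u\times\hat n)(v\times\hat n)\,ds$, $\|u\|_\Gamma^2=\langle u,u\rangle_\Gamma$. Let $V$ be the space of all $u\in H_0(\mathrm{curl};\Omega)$ (that is, $u\in L^2(\Omega)^2$, $\nabla\times u\in L^2(\Omega)$, $\hat\nu\times u=0$ on $\partial\Omega$) whose tangential trace $u\times\hat n$ on $\Gamma$ belongs to $L^2(\Gamma)$. Let $K_s\in H^1(0,T;L^2(\Omega))$, and let $$E\in C([0,T];V)\cap H^2(0,T;L^2(\Omega)^2),\quad H\in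 H^1(0,T;L^2(\Omega)),\quad J\in H^1(0,T;L^2(\Gamma)^2)$$ solve the zero-thickness graphene model: for all $\phi\in V$, $\psi\in L^2(\Omega)$, $\chi\in L^2(\Gamma)^2$, $$\tau_0\epsilon_0(\partial_{tt}E,\phi)+\epsilon_0(\partial_tE,\phi)+\tfrac{\tau_0}{\mu_0}(\nabla\times E,\nabla\times\phi)=(H,\nabla\times\phi)-\tfrac{\tau_0}{\mu_0}(K_s,\nabla\times\phi)-\sigma_0\langle E,\phi\rangle_\Gamma,$$ $$\mu_0(\partial_tH,\psi)=-(\nabla\times E,\psi)-(K_s,\psi),\qquad \tau_0\langle\partial_tJ,\chi\rangle_\Gamma+\langle J,\chi\rangle_\Gamma=\sigma_0\langle E,\chi\rangle_\Gamma,$$ the first equation for almost every $t\in(0,T)$ and the other two for every $t\in[0,T]$ (which fixes the values of $\partial_tH$ and of the tangential part of $\partial_tJ$ at every time), with the initial condition $\partial_tE(0)=\epsilon_0^{-1}\nabla\times H(0)$ and the interface condition $H_1-H_2=J\times\hat n$ on $\Gamma$ at time $0$ in the weak sense $$\epsilon_0(\partial_tE(0),\phi)=(H(0),\nabla\times\phi)-\langle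 J(0),\phi\rangle_\Gamma\qquad\text{for all }\phi\in V.$$ Define the energy $$ENG(t)=2\tau_0\epsilon_0\|\partial_tE\|^2+\sigma_0\|E\|_\Gamma^2+\mu_0\|\tau_0^{1/2}\partial_tH+\tau_0^{-1/2}H\|^2+\tfrac{\mu_0}{\tau_0}\|H\|^2+\tfrac{2\epsilon_0}{\tau_0}\|E\|^2+\tfrac{2}{\sigma_0}\|J\|_\Gamma^2+\tau_0\mu_0\|\partial_tH\|^2+\tfrac{\tau_0^2}{\sigma_0}\|\partial_tJ\|_\Gamma^2 .$$ Then there is a constant $C_*>0$ depending only on $\tau_0$ such that $$ENG(t)\le\Big[ENG(0)+\int_0^t\Big(\tfrac{\tau_0}{\mu_0}\|\partial_tK_s\|^2+\tfrac1{\tau_0\mu_0}\|K_s\|^2\Big)ds\Big]\exp(C_*t)\qquad\text{for all }t\in[0,T].$$ -/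

import Mathlib

open MeasureTheory Set
open scoped ENNReal NNReal

noncomputable section

namespace Graphene

/-- The Euclidean plane. -/
abbrev Plane : Type := EuclideanSpace ℝ (Fin 2)

/-- The scalar two-dimensional cross product `a × b = a_x b_y - a_y b_x`. -/
def cross (a b : Plane) : ℝ := a 0 * b 1 - a 1 * b 0

/-- The partial derivative `∂_i` of a function on the plane. -/
def partialDeriv {F : Type*} [NormedAddCommGroup F] [NormedSpace ℝ F]
    (i : Fin 2) (f : Plane → F) (x : Plane) : F :=
  fderiv ℝ f x (EuclideanSpace.single i 1)

/-- The curl of a scalar function, `∇ × ψ = (∂_y ψ, -∂_x ψ)`. -/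
def curlScalar (ψ : Plane → ℝ) (x : Plane) : Plane :=
  !₂[partialDeriv 1 ψ x, -partialDeriv 0 ψ x]

/-- The curl of a vector field, `∇ × φ = ∂_x φ_y - ∂_y φ_x`. -/
def curlVector (φ : Plane → Plane) (x : Plane) : ℝ :=
  partialDeriv 0 φ x 1 - partialDeriv 1 φ x 0

/-! ### The geometry -/

/-- A bounded Lipschitz polygonal domain of the plane: bounded, open and connected, its boundary
consists of finitely many segments, and near every boundary point it is, after a rotation (and
possibly a reflection), the set above the graph of a Lipschitz function. -/
structure IsLipschitzPolygon (Ω : Set Plane) : Prop where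
  isOpen : IsOpen Ω
  isBounded : Bornology.IsBounded Ω
  isConnected : IsConnected Ω
  polygonal : ∃ S : Finset (Plane × Plane), frontier Ω = ⋃ p ∈ S, segment ℝ p.1 p.2
  lipschitz : ∀ x ∈ frontier Ω, ∃ (e : Plane ≃ₗᵢ[ℝ] Plane) (f : ℝ → ℝ) (L : ℝ≥0) (r : ℝ),
    0 < r ∧ LipschitzWith L f ∧
      ∀ y ∈ Metric.ball x r, (y ∈ Ω ↔ f ((e y) 0) < (e y) 1)

/-- `Γ` is a sheet embedded in `Ω` (a curve which may be open or closed, may branch, have corners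
or several components, and may have end points on `∂Ω`), with unit normal field `n`: it consists
of finitely many regular simple `C¹` arcs that run in `Ω` and meet in end points only. -/
structure IsSheet (Ω Γ : Set Plane) (n : Plane → Plane) : Prop where
  arcs : ∃ (k : ℕ) (γ : Fin k → ℝ → Plane),
    (∀ i, ContDiffOn ℝ 1 (γ i) (Icc 0 1)) ∧
    (∀ i, InjOn (γ i) (Icc 0 1)) ∧
    (∀ i, ∀ s ∈ Icc (0 : ℝ) 1, derivWithin (γ i) (Icc 0 1) s ≠ 0) ∧
    (∀ i, MapsTo (γ i) (Ioo 0 1) Ω) ∧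
    (∀ i j, i ≠ j → Disjoint (γ i '' Ioo 0 1) (γ j '' Icc 0 1)) ∧
    Γ = ⋃ i, γ i '' Icc 0 1 ∧
    ∀ i, ∀ s ∈ Ioo (0 : ℝ) 1, ‖n (γ i s)‖ = 1 ∧
      inner ℝ (n (γ i s)) (derivWithin (γ i) (Icc 0 1) s) = 0
  measurable_normal : AEStronglyMeasurable n ((Measure.hausdorffMeasure 1).restrict Γ)

/-- Lebesgue measure on `Ω`. -/
abbrev area (Ω : Set Plane) : Measure Plane := volume.restrict Ω

/-- The arc length measure `ds` on `Γ`. -/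
abbrev arcLength (Γ : Set Plane) : Measure Plane := (Measure.hausdorffMeasure 1).restrict Γ

/-! ### Function spaces -/

/-- `L²(Ω)`; its inner product is `(·,·)` and its norm is `‖·‖`. -/
abbrev L2 (Ω : Set Plane) : Type := Lp ℝ 2 (area Ω)

/-- `(L²(Ω))²`; its inner product is `(·,·)` and its norm is `‖·‖`. -/
abbrev L2Vec (Ω : Set Plane) : Type := Lp Plane 2 (area Ω)

/-- `L²(Γ)`, the space of the tangential traces `φ × n`. -/
abbrev L2Sheet (Γ : Set Plane) : Type := Lp ℝ 2 (arcLength Γ)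

/-- `(L²(Γ))²`. -/
abbrev L2SheetVec (Γ : Set Plane) : Type := Lp Plane 2 (arcLength Γ)

/-- `u ∈ H₀(curl; Ω)` and `c = ∇ × u`. The test functions need not vanish on `∂Ω`, so that
Green's formula `∫_Ω (∇ × u) ψ = ∫_Ω u · (∇ × ψ) + ∫_∂Ω (ν × u) ψ ds` turns the requirement into
`∇ × u = c` in `Ω` (weakly) together with `ν × u = 0` on `∂Ω`. -/
def IsHZeroCurl (Ω : Set Plane) (u : L2Vec Ω) (c : L2 Ω) : Prop :=
  ∀ ψ : Plane → ℝ, ContDiff ℝ (⊤ : ℕ∞) ψ → HasCompactSupport ψ →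
    ∫ x in Ω, c x * ψ x = ∫ x in Ω, inner ℝ (u x) (curlScalar ψ x)

/-- `g ∈ L²(Γ)` is the tangential trace `u × n` on `Γ` of the field `u` whose curl is `c`:
there are smooth fields `φ` with `φ → u` in `H(curl; Ω)` and `φ × n → g` in `L²(Γ)`. -/
def IsTangentialTrace (Ω Γ : Set Plane) (n : Plane → Plane)
    (u : L2Vec Ω) (c : L2 Ω) (g : L2Sheet Γ) : Prop :=
  ∀ δ : ℝ≥0∞, 0 < δ → ∃ φ : Plane → Plane, ContDiff ℝ (⊤ : ℕ∞) φ ∧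
    eLpNorm (fun x => u x - φ x) 2 (area Ω) < δ ∧
    eLpNorm (fun x => c x - curlVector φ x) 2 (area Ω) < δ ∧
    eLpNorm (fun x => g x - cross (φ x) (n x)) 2 (arcLength Γ) < δ

/-- `u` is a field of `H₀(curl; Ω)` with curl `c` whose tangential trace on `Γ` is `g ∈ L²(Γ)`.
These are the fields for which all terms of the weak formulation are defined. -/
structure IsField (Ω Γ : Set Plane) (n : Plane → Plane)
    (u : L2Vec Ω) (c : L2 Ω) (g : L2Sheet Γ) : Prop where
  hZeroCurl : IsHZeroCurl Ω u c
  trace : IsTangentialTrace Ω Γ n u c g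

/-- `⟨j, φ⟩_Γ = ∫_Γ (j × n) (φ × n) ds`, where `g` stands for `φ × n`. -/
def sheetInner {Γ : Set Plane} (n : Plane → Plane) (j : L2SheetVec Γ) (g : L2Sheet Γ) : ℝ :=
  ∫ x, cross (j x) (n x) * g x ∂(arcLength Γ)

/-- `‖j‖_Γ² = ∫_Γ |j × n|² ds`. -/
def sheetNormSq {Γ : Set Plane} (n : Plane → Plane) (j : L2SheetVec Γ) : ℝ :=
  ∫ x, cross (j x) (n x) ^ 2 ∂(arcLength Γ)

/-- `u ∈ H¹(0,T; X)` with weak derivative `v = ∂_t u ∈ L²(0,T; X)`; here `u` is the continuous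
representative. -/
def HasTimeDeriv {X : Type*} [NormedAddCommGroup X] [NormedSpace ℝ X]
    (T : ℝ) (u v : ℝ → X) : Prop :=
  MemLp v 2 (volume.restrict (Icc 0 T)) ∧ ∀ t ∈ Icc 0 T, u t = u 0 + ∫ s in (0 : ℝ)..t, v s

/-! ### The model -/

/-- The unknowns, as functions of time, with their derivatives (`E_t` stands for `∂_t E`). -/
structure Unknowns (Ω Γ : Set Plane) where
  /-- electric field -/
  E : ℝ → L2Vec Ω
  E_t : ℝ → L2Vec Ω
  E_tt : ℝ → L2Vec Ω
  /-- `∇ × E` -/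
  curlE : ℝ → L2 Ω
  /-- the tangential trace `E × n` on `Γ` -/
  traceE : ℝ → L2Sheet Γ
  /-- magnetic field -/
  H : ℝ → L2 Ω
  H_t : ℝ → L2 Ω
  /-- surface current -/
  J : ℝ → L2SheetVec Γ
  J_t : ℝ → L2SheetVec Γ

/-- The fields `w` form a solution on `[0,T]`, with source `K` and `K_t = ∂_t K`, of the
reformulated system for `(E, H)` and of the relaxation law for the surface current `J`. -/
structure IsSolution (Ω Γ : Set Plane) (n : Plane → Plane) (T ε₀ μ₀ τ₀ σ₀ : ℝ)
    (K K_t : ℝ → L2 Ω) (w : Unknowns Ω Γ) : Prop where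
  /-- `E ∈ H²(0,T; (L²(Ω))²)` -/
  deriv_E : HasTimeDeriv T w.E w.E_t
  deriv_E_t : HasTimeDeriv T w.E_t w.E_tt
  /-- `H ∈ H¹(0,T; L²(Ω))` -/
  deriv_H : HasTimeDeriv T w.H w.H_t
  /-- `J ∈ H¹(0,T; (L²(Γ))²)` -/
  deriv_J : HasTimeDeriv T w.J w.J_t
  /-- `K ∈ H¹(0,T; L²(Ω))` -/
  deriv_K : HasTimeDeriv T K K_t
  /-- `E(t) ∈ H₀(curl; Ω)`, which contains the boundary condition `ν × E = 0`; `E × n ∈ L²(Γ)` -/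
  field_E : ∀ t ∈ Icc 0 T, IsField Ω Γ n (w.E t) (w.curlE t) (w.traceE t)
  /-- `E` is continuous in time with values in that space -/
  continuous_curlE : ContinuousOn w.curlE (Icc 0 T)
  continuous_traceE : ContinuousOn w.traceE (Icc 0 T)
  /-- `τ₀ε₀(∂_tt E, φ) + ε₀(∂_t E, φ) + (τ₀/μ₀)(∇×E, ∇×φ)
    = (H, ∇×φ) - (τ₀/μ₀)(K, ∇×φ) - σ₀⟨E, φ⟩_Γ` -/
  electric : ∀ᵐ t ∂(volume.restrict (Icc 0 T)), ∀ φ c g, IsField Ω Γ n φ c g →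
    τ₀ * ε₀ * inner ℝ (w.E_tt t) φ + ε₀ * inner ℝ (w.E_t t) φ
        + τ₀ / μ₀ * inner ℝ (w.curlE t) c
      = inner ℝ (w.H t) c - τ₀ / μ₀ * inner ℝ (K t) c - σ₀ * inner ℝ (w.traceE t) g
  /-- `μ₀(∂_t H, ψ) = -(∇×E, ψ) - (K, ψ)` -/
  magnetic : ∀ t ∈ Icc 0 T, ∀ ψ : L2 Ω,
    μ₀ * inner ℝ (w.H_t t) ψ = -inner ℝ (w.curlE t) ψ - inner ℝ (K t) ψ
  /-- `τ₀⟨∂_t J, χ⟩_Γ + ⟨J, χ⟩_Γ = σ₀⟨E, χ⟩_Γ` -/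
  current : ∀ t ∈ Icc 0 T, ∀ χ : L2SheetVec Γ,
    τ₀ * (∫ x, cross (w.J_t t x) (n x) * cross (χ x) (n x) ∂(arcLength Γ))
        + ∫ x, cross (w.J t x) (n x) * cross (χ x) (n x) ∂(arcLength Γ)
      = σ₀ * sheetInner n χ (w.traceE t)
  /-- The initial condition `∂_t E(0) = ε₀⁻¹ ∇ × H(0)`. By Green's formula, with the jump
  condition `H₁ - H₂ = J × n` on `Γ` at time `0`, this is the weak form of that condition. -/
  initial : ∀ φ c g, IsField Ω Γ n φ c g →
    ε₀ * inner ℝ (w.E_t 0) φ = inner ℝ (w.H 0) c - sheetInner n (w.J 0) g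

/-- The energy `ENG(t)`. -/
def energy {Ω Γ : Set Plane} (n : Plane → Plane) (ε₀ μ₀ τ₀ σ₀ : ℝ) (w : Unknowns Ω Γ)
    (t : ℝ) : ℝ :=
  2 * τ₀ * ε₀ * ‖w.E_t t‖ ^ 2
    + σ₀ * ‖w.traceE t‖ ^ 2
    + μ₀ * ‖√τ₀ • w.H_t t + (√τ₀)⁻¹ • w.H t‖ ^ 2
    + μ₀ / τ₀ * ‖w.H t‖ ^ 2
    + 2 * ε₀ / τ₀ * ‖w.E t‖ ^ 2
    + 2 / σ₀ * sheetNormSq n (w.J t)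
    + τ₀ * μ₀ * ‖w.H_t t‖ ^ 2
    + τ₀ ^ 2 / σ₀ * sheetNormSq n (w.J_t t)

end Graphene

end

open MeasureTheory Set
open scoped ENNReal NNReal

namespace Graphene

/-! ### Calculus of Hilbert- and Banach-valued functions in `H¹(0,T)`. -/

section Calculus

open Filter Topology intervalIntegral

variable {X : Type*} [NormedAddCommGroup X]

/-! The second order electric equation is a disguised first order one. For a fixed test triple
(field, curl, trace) let R be the residual of ε(∂_tE, φ) = (H, ∇×φ) - ⟨J, φ⟩_Γ. Inserting the
magnetic and current equations into the electric one gives τR' + R = 0, and the initial and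
interface conditions say R(0) = 0, so R vanishes at every time (`first_order`).

The first order system has an energy balance for the quantity ε‖E‖² + μ‖H‖² + (τ/σ)‖J‖_Γ²
(`energy_balance`): test the equations with E, H and J. The same quantity for the time derivatives
cannot be treated by differentiating the system, since ∂_tE need not have a curl or a trace. It is
obtained from the balance for the increments E(·+δ) - E, which are admissible because V is closed
under subtraction; dividing by δ² and letting δ → 0 gives `deriv_energy_le`.

By `energy_eq`, ENG is 2τ times the derivative energy plus 2/τ times the energy, up to -(1/σ)‖J‖_Γ²
and the cross term ε(∂_tE, E) + (H, K), whose time derivative is computed in `integral_cross_term`.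
Young's inequality splits the sources off, the remaining integrand is at most (8 + 2/τ) ENG, and
Grönwall's inequality concludes.

The argument runs in abstract Hilbert spaces, where only the tangential part j = J × n of the
current appears; `IsSolution.isAbstractSolution` transfers the concrete model. -/

theorem intervalIntegrable_of_memLp {T : ℝ} {v : ℝ → X}
    (hv : MemLp v 2 (volume.restrict (Icc 0 T))) {a b : ℝ} (ha : a ∈ Icc 0 T) (hb : b ∈ Icc 0 T) :
    IntervalIntegrable v volume a b := by
  have h : IntegrableOn v (Icc 0 T) := hv.integrable (by norm_num)
  exact (h.mono_set (uIcc_subset_Icc ha hb)).intervalIntegrable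

theorem intervalIntegrable_sq_of_memLp {T : ℝ} {v : ℝ → X}
    (hv : MemLp v 2 (volume.restrict (Icc 0 T))) {a b : ℝ} (ha : a ∈ Icc 0 T) (hb : b ∈ Icc 0 T) :
    IntervalIntegrable (fun s => ‖v s‖ ^ 2) volume a b := by
  have h : IntegrableOn (fun s => ‖v s‖ ^ 2) (Icc 0 T) := hv.integrable_norm_pow (by norm_num)
  exact (h.mono_set (uIcc_subset_Icc ha hb)).intervalIntegrable

theorem intervalIntegrable_of_continuousOn {T : ℝ} {v : ℝ → X}
    (hv : ContinuousOn v (Icc 0 T)) {a b : ℝ} (ha : a ∈ Icc 0 T) (hb : b ∈ Icc 0 T) :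
    IntervalIntegrable v volume a b :=
  (hv.mono (uIcc_subset_Icc ha hb)).intervalIntegrable

variable [NormedSpace ℝ X]

/-- Cauchy–Schwarz for the integral over an interval. -/
theorem sq_norm_integral_le {v : ℝ → X} {a h : ℝ} (hh : 0 < h)
    (hv : IntervalIntegrable v volume a (a + h))
    (hv2 : IntervalIntegrable (fun s => ‖v s‖ ^ 2) volume a (a + h)) :
    ‖∫ s in a..a + h, v s‖ ^ 2 ≤ h * ∫ s in a..a + h, ‖v s‖ ^ 2 := by
  have hab : a ≤ a + h := by linarith
  set A := ∫ s in a..a + h, ‖v s‖ with hA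
  have h1 : ‖∫ s in a..a + h, v s‖ ≤ A := norm_integral_le_integral_norm hab
  -- A/h is the mean of ‖v‖, so Cauchy–Schwarz is the nonnegativity of the variance.
  have h2 : 0 ≤ ∫ s in a..a + h, (‖v s‖ - A / h) ^ 2 :=
    integral_nonneg hab fun _ _ => sq_nonneg _
  have h3 : ∫ s in a..a + h, (‖v s‖ - A / h) ^ 2
      = (∫ s in a..a + h, ‖v s‖ ^ 2) - 2 * (A / h) * A + h * (A / h) ^ 2 := by
    have : (fun s => (‖v s‖ - A / h) ^ 2)
        = fun s => ‖v s‖ ^ 2 - 2 * (A / h) * ‖v s‖ + (A / h) ^ 2 := by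
      ext s; ring
    rw [this, integral_add (hv2.sub (hv.norm.const_mul _)) intervalIntegrable_const,
      integral_sub hv2 (hv.norm.const_mul _), intervalIntegral.integral_const_mul, intervalIntegral.integral_const]
    simp [hA]
  have h4 : h * (A / h) ^ 2 = A ^ 2 / h := by field_simp
  have h5 : 2 * (A / h) * A = 2 * (A ^ 2 / h) := by ring
  have h6 : A ^ 2 / h ≤ ∫ s in a..a + h, ‖v s‖ ^ 2 := by
    rw [h3, h4, h5] at h2; linarith
  rw [div_le_iff₀ hh] at h6
  calc _ ≤ A ^ 2 := by gcongr
    _ ≤ _ := by linarith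

variable {T : ℝ} {u v : ℝ → X}

namespace HasTimeDeriv

theorem sub_eq (hu : HasTimeDeriv T u v) {a b : ℝ} (ha : a ∈ Icc 0 T) (hb : b ∈ Icc 0 T) :
    u b - u a = ∫ s in a..b, v s := by
  have h0 : (0 : ℝ) ∈ Icc 0 T := ⟨le_rfl, ha.1.trans ha.2⟩
  rw [hu.2 a ha, hu.2 b hb, ← integral_add_adjacent_intervals
    (intervalIntegrable_of_memLp hu.1 h0 ha) (intervalIntegrable_of_memLp hu.1 ha hb)]
  abel

theorem continuousOn (hu : HasTimeDeriv T u v) : ContinuousOn u (Icc 0 T) := by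
  rcases lt_or_ge T 0 with hT | hT
  · simp [Icc_eq_empty hT.not_ge]
  have h0 : (0 : ℝ) ∈ Icc 0 T := ⟨le_rfl, hT⟩
  have h1 := continuousOn_primitive_interval'
    (intervalIntegrable_of_memLp hu.1 h0 ⟨hT, le_rfl⟩) left_mem_uIcc
  rw [uIcc_of_le hT] at h1
  exact (continuousOn_const.add h1).congr fun t ht => hu.2 t ht

theorem congr_deriv (hu : HasTimeDeriv T u v) {v' : ℝ → X}
    (h : v =ᵐ[volume.restrict (Icc 0 T)] v') : HasTimeDeriv T u v' := by
  refine ⟨hu.1.ae_eq h, fun t ht => ?_⟩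
  rw [hu.2 t ht]
  congr 1
  refine integral_congr_ae_restrict ?_
  rw [uIoc_of_le ht.1]
  exact ae_restrict_of_ae_restrict_of_subset
    (Ioc_subset_Icc_self.trans (Icc_subset_Icc_right ht.2)) h

theorem comp_shift (hu : HasTimeDeriv T u v) {h : ℝ} (hh : 0 ≤ h) (hT : h ≤ T) :
    HasTimeDeriv (T - h) (fun r => u (r + h)) (fun r => v (r + h)) := by
  have hmp : MeasurePreserving (fun r : ℝ => r + h) (volume.restrict (Icc 0 (T - h)))
      (volume.restrict (Icc h T)) := by
    have := (measurePreserving_add_right (volume : Measure ℝ) h).restrict_preimage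
      (measurableSet_Icc : MeasurableSet (Icc h T))
    simpa using this
  refine ⟨(hu.1.mono_measure (Measure.restrict_mono_set _
    (Icc_subset_Icc_left hh))).comp_measurePreserving hmp, fun t ht => ?_⟩
  have h1 := hu.sub_eq (a := h) (b := t + h) ⟨hh, hT⟩ ⟨by linarith [ht.1], by linarith [ht.2]⟩
  have h2 := integral_comp_add_right (a := 0) (b := t) v h
  rw [zero_add] at h2
  simp only [zero_add]
  rw [h2, ← h1]
  abel

theorem mono (hu : HasTimeDeriv T u v) {T' : ℝ} (hT : T' ≤ T) : HasTimeDeriv T' u v :=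
  ⟨hu.1.mono_measure (Measure.restrict_mono_set _ (Icc_subset_Icc_right hT)),
    fun t ht => hu.2 t ⟨ht.1, ht.2.trans hT⟩⟩

theorem sub {u' v' : ℝ → X} (hu : HasTimeDeriv T u v) (hu' : HasTimeDeriv T u' v') :
    HasTimeDeriv T (fun t => u t - u' t) (fun t => v t - v' t) := by
  refine ⟨hu.1.sub hu'.1, fun t ht => ?_⟩
  have h0 : (0 : ℝ) ∈ Icc 0 T := ⟨le_rfl, ht.1.trans ht.2⟩
  rw [integral_sub (intervalIntegrable_of_memLp hu.1 h0 ht)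
    (intervalIntegrable_of_memLp hu'.1 h0 ht), ← hu.sub_eq h0 ht, ← hu'.sub_eq h0 ht]
  module

theorem map [CompleteSpace X] {Y : Type*} [NormedAddCommGroup Y] [NormedSpace ℝ Y]
    [CompleteSpace Y] (L : X →L[ℝ] Y)
    (hu : HasTimeDeriv T u v) : HasTimeDeriv T (fun t => L (u t)) (fun t => L (v t)) := by
  refine ⟨L.comp_memLp' hu.1, fun t ht => ?_⟩
  have h0 : (0 : ℝ) ∈ Icc 0 T := ⟨le_rfl, ht.1.trans ht.2⟩
  rw [L.intervalIntegral_comp_comm (intervalIntegrable_of_memLp hu.1 h0 ht),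
    ← hu.sub_eq h0 ht, map_sub]
  abel

/-- When the derivative is continuous, one-sided difference quotients converge at every time before
T, not just almost everywhere. This identifies the limits of the increment energies at the two fixed
times 0 and t. -/
theorem tendsto_slope [CompleteSpace X] (hu : HasTimeDeriv T u v)
    (hv : ContinuousOn v (Icc 0 T)) {t : ℝ}
    (ht : t ∈ Ico 0 T) : Tendsto (fun h => h⁻¹ • (u (t + h) - u t)) (𝓝[>] 0) (𝓝 (v t)) := by
  have ht' : t ∈ Icc 0 T := ⟨ht.1, ht.2.le⟩
  have h0 : (0 : ℝ) ∈ Icc 0 T := ⟨le_rfl, ht.1.trans ht.2.le⟩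
  have hnhds : Icc 0 T ∈ 𝓝[>] t :=
    mem_of_superset (Ioc_mem_nhdsGT ht.2)
      (fun x hx => ⟨ht.1.trans hx.1.le, hx.2⟩)
  have hd : HasDerivWithinAt (fun x => ∫ s in (0 : ℝ)..x, v s) (v t) (Ici t) t := by
    refine integral_hasDerivWithinAt_right (t := Ioi t)
      (intervalIntegrable_of_memLp hu.1 h0 ht') ?_ ?_
    · exact ⟨Icc 0 T, hnhds, hv.aestronglyMeasurable measurableSet_Icc⟩
    · exact (hv t ht').mono_of_mem_nhdsWithin hnhds
  have hd2 : HasDerivWithinAt u (v t) (Ioi t) t := by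
    refine (hd.const_add (u 0)).Ioi_of_Ici.congr_of_eventuallyEq ?_ (hu.2 t ht')
    filter_upwards [hnhds] with x hx using hu.2 x hx
  rw [hasDerivWithinAt_iff_tendsto_slope' self_notMem_Ioi] at hd2
  have hmap : Tendsto (fun h : ℝ => t + h) (𝓝[>] 0) (𝓝[>] t) := by
    refine tendsto_nhdsWithin_iff.2 ⟨?_, ?_⟩
    · exact ((continuous_const.add continuous_id).tendsto' 0 t (by simp)).mono_left
        nhdsWithin_le_nhds
    · filter_upwards [self_mem_nhdsWithin] with h hh
      have : (0 : ℝ) < h := hh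
      simpa using this
  refine (hd2.comp hmap).congr fun h => ?_
  simp [slope]

theorem ae_hasDerivAt [CompleteSpace X] (hu : HasTimeDeriv T u v) :
    ∀ᵐ t, t ∈ Ioo 0 T → HasDerivAt u (v t) t := by
  rcases lt_or_ge T 0 with hT | hT
  · simp [Ioo_eq_empty hT.le.not_gt]
  have h0 : (0 : ℝ) ∈ Icc 0 T := ⟨le_rfl, hT⟩
  filter_upwards [(intervalIntegrable_of_memLp hu.1 h0 ⟨hT, le_rfl⟩).ae_hasDerivAt_integral]
    with t h ht
  have h1 := h (by rw [uIcc_of_le hT]; exact Ioo_subset_Icc_self ht) 0 left_mem_uIcc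
  refine (h1.const_add (u 0)).congr_of_eventuallyEq ?_
  filter_upwards [Ioo_mem_nhds ht.1 ht.2] with x hx using hu.2 x (Ioo_subset_Icc_self hx)

/-- The `L²` norm of the difference quotients of `u` is asymptotically bounded by that of `∂_t u`. -/
theorem exists_bound_integral_sq_shift (hu : HasTimeDeriv T u v) {t : ℝ} (ht : t ∈ Ico 0 T) :
    ∃ F : ℝ → ℝ, Tendsto F (𝓝[>] 0) (𝓝 (∫ s in (0 : ℝ)..t, ‖v s‖ ^ 2)) ∧
      ∀ h, 0 < h → h ≤ T - t → ∫ r in (0 : ℝ)..t, ‖u (r + h) - u r‖ ^ 2 ≤ h ^ 2 * F h := by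
  have hT : 0 ≤ T := ht.1.trans ht.2.le
  have h0 : (0 : ℝ) ∈ Icc 0 T := ⟨le_rfl, hT⟩
  have ht' : t ∈ Icc 0 T := ⟨ht.1, ht.2.le⟩
  set Φ : ℝ → ℝ := fun r => ∫ s in (0 : ℝ)..r, ‖v s‖ ^ 2 with hΦ
  have hΦc : ContinuousOn Φ (Icc 0 T) := by
    have := continuousOn_primitive_interval'
      (intervalIntegrable_sq_of_memLp hu.1 h0 ⟨hT, le_rfl⟩) left_mem_uIcc
    rwa [uIcc_of_le hT] at this
  -- A second primitive: the integral of Φ(r + h) - Φ(r) over (0,t) is Ψ(t + h) - Ψ(t) - Ψ(h), so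
  -- the bound F is a difference of two difference quotients of Ψ, with limit Φ(t) - Φ(0).
  set Ψ : ℝ → ℝ := fun r => ∫ s in (0 : ℝ)..r, Φ s with hΨ
  have hlim : ∀ x ∈ Ico 0 T, Tendsto (fun h => h⁻¹ • (Ψ (x + h) - Ψ x)) (𝓝[>] 0) (𝓝 (Φ x)) := by
    intro x hx
    have hm : MemLp Φ 2 (volume.restrict (Icc 0 T)) := by
      obtain ⟨M, hM⟩ := isCompact_Icc.exists_bound_of_continuousOn hΦc
      exact MemLp.of_bound (hΦc.aestronglyMeasurable measurableSet_Icc) M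
        (ae_restrict_of_forall_mem measurableSet_Icc hM)
    exact HasTimeDeriv.tendsto_slope (u := Ψ) ⟨hm, fun t _ => by simp [hΨ]⟩ hΦc hx
  refine ⟨fun h => h⁻¹ • (Ψ (t + h) - Ψ t) - h⁻¹ • (Ψ (0 + h) - Ψ 0), ?_, fun h hh hht => ?_⟩
  · have := (hlim t ht).sub (hlim 0 ⟨le_rfl, ht.1.trans_lt ht.2⟩)
    simpa [hΦ] using this
  have hmem : ∀ r ∈ Icc 0 t, r ∈ Icc 0 T ∧ r + h ∈ Icc 0 T := fun r hr =>
    ⟨⟨hr.1, hr.2.trans ht'.2⟩, by linarith [hr.1], by linarith [hr.2]⟩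
  have hshift : ContinuousOn (fun r => r + h) (Icc 0 t) := by fun_prop
  have hmaps : MapsTo (fun r => r + h) (Icc 0 t) (Icc 0 T) := fun r hr => (hmem r hr).2
  have hsub : Icc 0 t ⊆ Icc 0 T := fun r hr => (hmem r hr).1
  have h0t : (0 : ℝ) ∈ Icc 0 t := ⟨le_rfl, ht.1⟩
  have htt : t ∈ Icc 0 t := ⟨ht.1, le_rfl⟩
  have i1 : IntervalIntegrable (fun r => ‖u (r + h) - u r‖ ^ 2) volume 0 t :=
    intervalIntegrable_of_continuousOn (T := t)
      (((hu.continuousOn.comp hshift hmaps).sub (hu.continuousOn.mono hsub)).norm.pow 2) h0t htt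
  have i2 : IntervalIntegrable (fun r => Φ (r + h)) volume 0 t :=
    intervalIntegrable_of_continuousOn (hΦc.comp hshift hmaps) h0t htt
  have i3 : IntervalIntegrable Φ volume 0 t :=
    intervalIntegrable_of_continuousOn (hΦc.mono hsub) h0t htt
  have key : ∫ r in (0 : ℝ)..t, ‖u (r + h) - u r‖ ^ 2
      ≤ ∫ r in (0 : ℝ)..t, h * (Φ (r + h) - Φ r) := by
    refine integral_mono_on ht.1 i1 ((i2.sub i3).const_mul h) fun r hr => ?_
    obtain ⟨hr1, hr2⟩ := hmem r hr
    rw [hu.sub_eq hr1 hr2]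
    have e : Φ (r + h) - Φ r = ∫ s in r..r + h, ‖v s‖ ^ 2 :=
      integral_interval_sub_left (intervalIntegrable_sq_of_memLp hu.1 h0 hr2)
        (intervalIntegrable_sq_of_memLp hu.1 h0 hr1)
    rw [e]
    exact sq_norm_integral_le hh (intervalIntegrable_of_memLp hu.1 hr1 hr2)
      (intervalIntegrable_sq_of_memLp hu.1 hr1 hr2)
  refine key.trans (le_of_eq ?_)
  have hhT : h ∈ Icc 0 T := by simpa using (hmem 0 h0t).2
  have hthT : t + h ∈ Icc 0 T := (hmem t htt).2
  have iΦ : ∀ {a b}, a ∈ Icc 0 T → b ∈ Icc 0 T → IntervalIntegrable Φ volume a b :=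
    fun ha hb => intervalIntegrable_of_continuousOn hΦc ha hb
  rw [intervalIntegral.integral_const_mul, integral_sub i2 i3, integral_comp_add_right]
  have e1 : ∫ s in (0 + h)..(t + h), Φ s = Ψ (t + h) - Ψ h := by
    rw [zero_add]
    exact (integral_interval_sub_left (iΦ h0 hthT) (iΦ h0 hhT)).symm
  have e0 : Ψ 0 = 0 := by simp [hΨ]
  have e2 : ∫ s in (0 : ℝ)..t, Φ s = Ψ t := rfl
  rw [e1, e2]
  simp only [zero_add, e0, smul_eq_mul, sub_zero]
  field_simp
  ring

end HasTimeDeriv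

end Calculus

/-! ### Product rule for inner products. -/

section Inner

open Filter Topology intervalIntegral

variable {X : Type*} [NormedAddCommGroup X] [InnerProductSpace ℝ X]

theorem intervalIntegrable_inner {f g : ℝ → X} {a b : ℝ} (hf : IntervalIntegrable f volume a b)
    (hg : ContinuousOn g (uIcc a b)) :
    IntervalIntegrable (fun s => inner ℝ (f s) (g s)) volume a b := by
  obtain ⟨M, hM⟩ := isCompact_uIcc.exists_bound_of_continuousOn hg
  have hgm : AEStronglyMeasurable g (volume.restrict (uIoc a b)) :=
    (hg.mono uIoc_subset_uIcc).aestronglyMeasurable measurableSet_uIoc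
  refine (hf.norm.mul_const M).mono_fun (hf.aestronglyMeasurable_restrict_uIoc.inner hgm) ?_
  refine ae_restrict_of_forall_mem measurableSet_uIoc fun s hs => ?_
  have h1 := hM s (uIoc_subset_uIcc hs)
  calc _ ≤ ‖f s‖ * ‖g s‖ := norm_inner_le_norm _ _
    _ ≤ ‖f s‖ * M := by gcongr
    _ ≤ _ := le_abs_self _

/-- The sums in the definition of absolute continuity are dominated termwise by those of G. In use,
G is the primitive of an integrable majorant. -/
theorem absolutelyContinuousOnInterval_of_dist_le {Y : Type*} [PseudoMetricSpace Y] {f : ℝ → Y}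
    {G : ℝ → ℝ} {a b : ℝ} (hG : AbsolutelyContinuousOnInterval G a b)
    (h : ∀ x ∈ uIcc a b, ∀ y ∈ uIcc a b, dist (f x) (f y) ≤ dist (G x) (G y)) :
    AbsolutelyContinuousOnInterval f a b := by
  refine squeeze_zero' (.of_forall fun _ => Finset.sum_nonneg fun _ _ => dist_nonneg) ?_ hG
  rw [eventually_inf_principal]
  refine .of_forall fun E hE => Finset.sum_le_sum fun i hi => ?_
  exact h _ (hE.1 i hi).1 _ (hE.1 i hi).2

variable [CompleteSpace X] {T : ℝ}

/-- The product rule for the inner product of two functions of `H¹(0,T; X)`. -/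
theorem HasTimeDeriv.integral_inner {u v x y : ℝ → X} (hu : HasTimeDeriv T u v)
    (hx : HasTimeDeriv T x y) {t : ℝ} (ht : t ∈ Icc 0 T) :
    IntervalIntegrable (fun s => (inner ℝ (v s) (x s) + inner ℝ (u s) (y s) : ℝ)) volume 0 t ∧
    ∫ s in (0 : ℝ)..t, (inner ℝ (v s) (x s) + inner ℝ (u s) (y s) : ℝ)
      = inner ℝ (u t) (x t) - inner ℝ (u 0) (x 0) := by
  have h0 : (0 : ℝ) ∈ Icc 0 T := ⟨le_rfl, ht.1.trans ht.2⟩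
  have hsub : uIcc 0 t ⊆ Icc 0 T := uIcc_subset_Icc h0 ht
  have iv := intervalIntegrable_of_memLp hu.1 h0 ht
  have iy := intervalIntegrable_of_memLp hx.1 h0 ht
  have cu := hu.continuousOn.mono hsub
  have cx := hx.continuousOn.mono hsub
  have i2 : IntervalIntegrable (fun s => (inner ℝ (u s) (y s) : ℝ)) volume 0 t := by
    simpa only [real_inner_comm] using intervalIntegrable_inner iy cu
  refine ⟨(intervalIntegrable_inner iv cx).add i2, ?_⟩
  obtain ⟨M, hM⟩ := isCompact_uIcc.exists_bound_of_continuousOn cu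
  obtain ⟨N, hN⟩ := isCompact_uIcc.exists_bound_of_continuousOn cx
  have im : IntervalIntegrable (fun s => N * ‖v s‖ + M * ‖y s‖) volume 0 t :=
    (iv.norm.const_mul N).add (iy.norm.const_mul M)
  -- With ‖u‖ ≤ M and ‖x‖ ≤ N, an increment of the inner product is at most the integral of N‖v‖ +
  -- M‖y‖; the fundamental theorem for absolutely continuous functions then applies.
  have hac : AbsolutelyContinuousOnInterval (fun s => (inner ℝ (u s) (x s) : ℝ)) 0 t := by
    refine absolutelyContinuousOnInterval_of_dist_le
      (im.absolutelyContinuousOnInterval_intervalIntegral left_mem_uIcc) ?_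
    have key : ∀ a ∈ uIcc 0 t, ∀ b ∈ uIcc 0 t, a ≤ b →
        dist (inner ℝ (u a) (x a) : ℝ) (inner ℝ (u b) (x b))
          ≤ dist (∫ s in (0 : ℝ)..a, (N * ‖v s‖ + M * ‖y s‖))
            (∫ s in (0 : ℝ)..b, (N * ‖v s‖ + M * ‖y s‖)) := by
      intro a ha b hb hab
      have hss : uIcc a b ⊆ uIcc 0 t := uIcc_subset_uIcc ha hb
      have iv' := iv.mono_set hss
      have iy' := iy.mono_set hss
      rw [dist_comm, dist_comm (∫ s in (0 : ℝ)..a, _), Real.dist_eq, Real.dist_eq,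
        integral_interval_sub_left (im.mono_set (uIcc_subset_uIcc left_mem_uIcc hb))
          (im.mono_set (uIcc_subset_uIcc left_mem_uIcc ha))]
      refine le_trans ?_ (le_abs_self _)
      rw [integral_add (iv'.norm.const_mul N) (iy'.norm.const_mul M), intervalIntegral.integral_const_mul,
        intervalIntegral.integral_const_mul]
      have e : (inner ℝ (u b) (x b) : ℝ) - inner ℝ (u a) (x a)
          = inner ℝ (u b - u a) (x b) + inner ℝ (u a) (x b - x a) := by
        simp [inner_sub_left, inner_sub_right]
      rw [e, hu.sub_eq (hsub ha) (hsub hb), hx.sub_eq (hsub ha) (hsub hb)]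
      refine (abs_add_le _ _).trans (add_le_add ?_ ?_)
      · refine (abs_real_inner_le_norm _ _).trans ?_
        rw [mul_comm]
        exact mul_le_mul (hN b hb) (norm_integral_le_integral_norm hab) (norm_nonneg _)
          ((norm_nonneg _).trans (hN b hb))
      · refine (abs_real_inner_le_norm _ _).trans ?_
        exact mul_le_mul (hM a ha) (norm_integral_le_integral_norm hab) (norm_nonneg _)
          ((norm_nonneg _).trans (hM a ha))
    intro a ha b hb
    rcases le_total a b with hab | hab
    · exact key a ha b hb hab
    · rw [dist_comm, dist_comm (∫ s in (0 : ℝ)..a, _)]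
      exact key b hb a ha hab
  rw [← hac.integral_deriv_eq_sub]
  refine integral_congr_ae ?_
  have hne : ∀ᵐ s : ℝ, s ≠ T := by simp [ae_iff, measure_singleton]
  filter_upwards [hu.ae_hasDerivAt, hx.ae_hasDerivAt, hne] with s h1 h2 h3 hs
  rw [uIoc_of_le ht.1] at hs
  have hs' : s ∈ Ioo 0 T := ⟨hs.1, lt_of_le_of_ne (hs.2.trans ht.2) h3⟩
  rw [((h1 hs').inner ℝ (h2 hs')).deriv, add_comm]

theorem HasTimeDeriv.integral_norm_sq {u v : ℝ → X} (hu : HasTimeDeriv T u v) {t : ℝ}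
    (ht : t ∈ Icc 0 T) :
    IntervalIntegrable (fun s => 2 * (inner ℝ (v s) (u s) : ℝ)) volume 0 t ∧
    ∫ s in (0 : ℝ)..t, 2 * (inner ℝ (v s) (u s) : ℝ) = ‖u t‖ ^ 2 - ‖u 0‖ ^ 2 := by
  have h := hu.integral_inner hu ht
  have e : ∀ s, (inner ℝ (v s) (u s) + inner ℝ (u s) (v s) : ℝ) = 2 * inner ℝ (v s) (u s) :=
    fun s => by rw [real_inner_comm (v s) (u s)]; ring
  simpa only [e, real_inner_self_eq_norm_sq] using h

end Inner

/-! ### Grönwall's inequality. -/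

section Gronwall

open intervalIntegral Filter Topology

/-- Grönwall's inequality in integral form. -/
theorem le_mul_exp_of_le_add_integral {T C y₀ : ℝ} (hC : 0 ≤ C) {y S : ℝ → ℝ}
    (hy : ContinuousOn y (Icc 0 T)) (hS : ∀ s ∈ Icc 0 T, 0 ≤ S s)
    (hSi : ∀ t ∈ Icc 0 T, IntervalIntegrable S volume 0 t)
    (h : ∀ t ∈ Icc 0 T, y t ≤ y₀ + ∫ s in (0 : ℝ)..t, (S s + C * y s)) {t : ℝ}
    (ht : t ∈ Icc 0 T) : y t ≤ (y₀ + ∫ s in (0 : ℝ)..t, S s) * Real.exp (C * t) := by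
  have h0 : (0 : ℝ) ∈ Icc 0 T := ⟨le_rfl, ht.1.trans ht.2⟩
  set δ := y₀ + ∫ s in (0 : ℝ)..t, S s with hδ
  -- The source integral is frozen at its value at the final time t, an upper bound because S ≥ 0.
  -- Thus y ≤ W and W' = Cy ≤ CW, with a constant initial value.
  set W : ℝ → ℝ := fun r => δ + C * ∫ s in (0 : ℝ)..r, y s with hW
  have hle : ∀ r ∈ Icc 0 t, y r ≤ W r := by
    intro r hr
    have hrT : r ∈ Icc 0 T := ⟨hr.1, hr.2.trans ht.2⟩
    refine (h r hrT).trans ?_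
    rw [integral_add (hSi r hrT) ((intervalIntegrable_of_continuousOn hy h0 hrT).const_mul C),
      intervalIntegral.integral_const_mul]
    have hrt : IntervalIntegrable S volume r t := (hSi r hrT).symm.trans (hSi t ht)
    have h1 := integral_add_adjacent_intervals (hSi r hrT) hrt
    have h2 : 0 ≤ ∫ s in r..t, S s :=
      integral_nonneg hr.2 fun s hs => hS s ⟨hr.1.trans hs.1, hs.2.trans ht.2⟩
    simp only [hW, hδ]
    linarith
  have hyt : ContinuousOn y (Icc 0 t) := hy.mono (Icc_subset_Icc_right ht.2)
  have hWc : ContinuousOn W (Icc 0 t) := by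
    have := continuousOn_primitive_interval'
      (intervalIntegrable_of_continuousOn hy h0 ht) left_mem_uIcc
    rw [uIcc_of_le ht.1] at this
    exact continuousOn_const.add (continuousOn_const.mul this)
  have hWd : ∀ r ∈ Ico 0 t, HasDerivWithinAt W (C * y r) (Ici r) r := by
    intro r hr
    have hnhds : Icc 0 t ∈ 𝓝[>] r :=
      mem_of_superset (Ioc_mem_nhdsGT hr.2) (fun x hx => ⟨hr.1.trans hx.1.le, hx.2⟩)
    refine (HasDerivWithinAt.const_mul C ?_).const_add δ
    refine integral_hasDerivWithinAt_right (t := Ioi r)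
      (intervalIntegrable_of_continuousOn hyt ⟨le_rfl, ht.1⟩ ⟨hr.1, hr.2.le⟩) ?_ ?_
    · exact ⟨Icc 0 t, hnhds, hyt.aestronglyMeasurable measurableSet_Icc⟩
    · exact (hyt r ⟨hr.1, hr.2.le⟩).mono_of_mem_nhdsWithin hnhds
  have hg := le_gronwallBound_of_liminf_deriv_right_le (K := C) (ε := 0) (δ := δ) hWc
    (fun r hr _ hlt => (hWd r hr).liminf_right_slope_le hlt) (by simp [hW])
    (fun r hr => by
      rw [add_zero]
      exact mul_le_mul_of_nonneg_left (hle r ⟨hr.1, hr.2.le⟩) hC) t ⟨ht.1, le_rfl⟩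
  rw [gronwallBound_ε0, sub_zero] at hg
  exact (hle t ⟨ht.1, le_rfl⟩).trans hg

end Gronwall

/-! ### The abstract system: first order form and energy balances. -/

section AbstractSystem

open intervalIntegral Filter Topology

variable {A B G : Type*} [NormedAddCommGroup A] [InnerProductSpace ℝ A]
  [NormedAddCommGroup B] [InnerProductSpace ℝ B] [NormedAddCommGroup G] [InnerProductSpace ℝ G]

/-- The graphene system in abstract Hilbert spaces; `V` is the set of the admissible triples of a
field, its curl and its trace, and `j` is the tangential part of the surface current. -/
structure IsAbstractSolution (V : Set (A × B × G)) (T ε μ τ σ : ℝ) (E E_t E_tt : ℝ → A)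
    (c H H_t K K_t : ℝ → B) (g j j_t : ℝ → G) : Prop where
  sub_mem : ∀ p ∈ V, ∀ q ∈ V, p - q ∈ V
  deriv_E : HasTimeDeriv T E E_t
  deriv_E_t : HasTimeDeriv T E_t E_tt
  deriv_H : HasTimeDeriv T H H_t
  deriv_j : HasTimeDeriv T j j_t
  deriv_K : HasTimeDeriv T K K_t
  mem : ∀ t ∈ Icc 0 T, (E t, c t, g t) ∈ V
  continuous_c : ContinuousOn c (Icc 0 T)
  continuous_g : ContinuousOn g (Icc 0 T)
  electric : ∀ᵐ t ∂(volume.restrict (Icc 0 T)), ∀ p ∈ V,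
    τ * ε * inner ℝ (E_tt t) p.1 + ε * inner ℝ (E_t t) p.1 + τ / μ * inner ℝ (c t) p.2.1
      = inner ℝ (H t) p.2.1 - τ / μ * inner ℝ (K t) p.2.1 - σ * inner ℝ (g t) p.2.2
  magnetic : ∀ t ∈ Icc 0 T, μ • H_t t = -c t - K t
  current : ∀ t ∈ Icc 0 T, τ • j_t t + j t = σ • g t
  initial : ∀ p ∈ V, ε * inner ℝ (E_t 0) p.1 = inner ℝ (H 0) p.2.1 - inner ℝ (j 0) p.2.2

namespace IsAbstractSolution

variable {V : Set (A × B × G)} {T ε μ τ σ : ℝ} {E E_t E_tt : ℝ → A}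
  {c H H_t K K_t : ℝ → B} {g j j_t : ℝ → G}

/-- The magnetic equation holds at every time and expresses ∂_tH through the continuous functions
∇×E and K. -/
theorem continuous_H_t (h : IsAbstractSolution V T ε μ τ σ E E_t E_tt c H H_t K K_t g j j_t)
    (hμ : 0 < μ) : ContinuousOn H_t (Icc 0 T) := by
  refine ((h.continuous_c.neg.sub h.deriv_K.continuousOn).const_smul μ⁻¹).congr fun t ht => ?_
  have := h.magnetic t ht
  change H_t t = μ⁻¹ • (-c t - K t)
  rw [← this, inv_smul_smul₀ hμ.ne']

theorem continuous_j_t (h : IsAbstractSolution V T ε μ τ σ E E_t E_tt c H H_t K K_t g j j_t)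
    (hτ : 0 < τ) : ContinuousOn j_t (Icc 0 T) := by
  refine (((h.continuous_g.const_smul σ).sub h.deriv_j.continuousOn).const_smul τ⁻¹).congr
    fun t ht => ?_
  have := h.current t ht
  simp only [Pi.sub_apply, Pi.smul_apply]
  rw [← this, add_sub_cancel_right, inv_smul_smul₀ hτ.ne']

end IsAbstractSolution

variable [CompleteSpace A] [CompleteSpace B] [CompleteSpace G]

/-- The energy balance of the first order system. -/
theorem energy_balance {T ε μ τ σ : ℝ} (hσ : 0 < σ) {E E_t : ℝ → A} {c H H_t K : ℝ → B}
    {g j j_t : ℝ → G} (dE : HasTimeDeriv T E E_t) (dH : HasTimeDeriv T H H_t)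
    (dj : HasTimeDeriv T j j_t)
    (hE : ∀ t ∈ Icc 0 T, ε * inner ℝ (E_t t) (E t) = inner ℝ (H t) (c t) - inner ℝ (j t) (g t))
    (hH : ∀ t ∈ Icc 0 T, μ • H_t t = -c t - K t)
    (hj : ∀ t ∈ Icc 0 T, τ • j_t t + j t = σ • g t) {t : ℝ} (ht : t ∈ Icc 0 T) :
    ε * ‖E t‖ ^ 2 + μ * ‖H t‖ ^ 2 + τ / σ * ‖j t‖ ^ 2
      = ε * ‖E 0‖ ^ 2 + μ * ‖H 0‖ ^ 2 + τ / σ * ‖j 0‖ ^ 2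
        + ∫ s in (0 : ℝ)..t, (-(2 / σ) * ‖j s‖ ^ 2 - 2 * inner ℝ (H s) (K s)) := by
  obtain ⟨iE, eE⟩ := dE.integral_norm_sq ht
  obtain ⟨iH, eH⟩ := dH.integral_norm_sq ht
  obtain ⟨ij, ej⟩ := dj.integral_norm_sq ht
  -- The curl terms of the electric and magnetic equations cancel, and so do the trace terms of the
  -- electric and current equations; only damping and source remain.
  have key : ∫ s in (0 : ℝ)..t, (-(2 / σ) * ‖j s‖ ^ 2 - 2 * inner ℝ (H s) (K s))
      = ∫ s in (0 : ℝ)..t, (ε * (2 * inner ℝ (E_t s) (E s)) + μ * (2 * inner ℝ (H_t s) (H s))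
        + τ / σ * (2 * inner ℝ (j_t s) (j s))) := by
    refine integral_congr fun s hs => ?_
    rw [uIcc_of_le ht.1] at hs
    have hs' : s ∈ Icc 0 T := ⟨hs.1, hs.2.trans ht.2⟩
    have h1 := hE s hs'
    have h2 := congrArg (fun x => (inner ℝ x (H s) : ℝ)) (hH s hs')
    have h3 := congrArg (fun x => (inner ℝ x (j s) : ℝ)) (hj s hs')
    simp only [inner_smul_left, inner_sub_left, inner_add_left, inner_neg_left,
      real_inner_self_eq_norm_sq, conj_trivial] at h2 h3
    rw [real_inner_comm (c s), real_inner_comm (g s)] at h1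
    rw [real_inner_comm (K s)]
    field_simp
    linear_combination -σ * h1 - σ * h2 - h3
  rw [key, integral_add ((iE.const_mul ε).add (iH.const_mul μ)) (ij.const_mul _),
    integral_add (iE.const_mul ε) (iH.const_mul μ),
    intervalIntegral.integral_const_mul _ (fun s => 2 * (inner ℝ (E_t s) (E s) : ℝ)),
    intervalIntegral.integral_const_mul _ (fun s => 2 * (inner ℝ (H_t s) (H s) : ℝ)),
    intervalIntegral.integral_const_mul _ (fun s => 2 * (inner ℝ (j_t s) (j s) : ℝ)), eE, eH, ej]
  ring

namespace IsAbstractSolution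

variable {V : Set (A × B × G)} {T ε μ τ σ : ℝ} {E E_t E_tt : ℝ → A}
  {c H H_t K K_t : ℝ → B} {g j j_t : ℝ → G}

/-- The first order weak form of the electric equation. -/
theorem first_order (h : IsAbstractSolution V T ε μ τ σ E E_t E_tt c H H_t K K_t g j j_t)
    (hμ : 0 < μ) (hτ : 0 < τ) {p : A × B × G} (hp : p ∈ V) {t : ℝ} (ht : t ∈ Icc 0 T) :
    ε * inner ℝ (E_t t) p.1 = inner ℝ (H t) p.2.1 - inner ℝ (j t) p.2.2 := by
  set R : ℝ → ℝ := fun t => ε * inner ℝ p.1 (E_t t) - inner ℝ p.2.1 (H t) + inner ℝ p.2.2 (j t)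
    with hR
  have h0 : (0 : ℝ) ∈ Icc 0 T := ⟨le_rfl, ht.1.trans ht.2⟩
  have d1 := h.deriv_E_t.map (innerSL ℝ (ε • p.1))
  have d2 := h.deriv_H.map (innerSL ℝ p.2.1)
  have d3 := h.deriv_j.map (innerSL ℝ (-p.2.2))
  -- The electric equation, with ∇×E + K replaced by -μ∂_tH and σE × n by τ∂_tj + j, reads τR' + R =
  -- 0.
  have dR : HasTimeDeriv T R (fun t => -τ⁻¹ * R t) := by
    have d := (d1.sub d2).sub d3
    have e : (fun t => innerSL ℝ (ε • p.1) (E_t t) - innerSL ℝ p.2.1 (H t)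
        - innerSL ℝ (-p.2.2) (j t)) = R := by
      ext s
      simp [hR]
    rw [e] at d
    refine d.congr_deriv ?_
    filter_upwards [h.electric, ae_restrict_mem measurableSet_Icc] with s hs hsT
    have h1 := hs p hp
    have h2 := congrArg (fun x => (inner ℝ x p.2.1 : ℝ)) (h.magnetic s hsT)
    have h3 := congrArg (fun x => (inner ℝ x p.2.2 : ℝ)) (h.current s hsT)
    simp only [inner_smul_left, inner_sub_left, inner_add_left, inner_neg_left,
      conj_trivial] at h2 h3
    simp only [hR, innerSL_apply_apply, inner_smul_left, inner_neg_left, conj_trivial]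
    rw [real_inner_comm (E_tt s), real_inner_comm (E_t s), real_inner_comm (H_t s),
      real_inner_comm (H s), real_inner_comm (j_t s), real_inner_comm (j s)]
    field_simp at h1 ⊢
    have hμ' : μ ≠ 0 := hμ.ne'
    apply mul_left_cancel₀ hμ'
    linear_combination h1 - τ * h2 + μ * h3
  have hR0 : R 0 = 0 := by
    have := h.initial p hp
    simp only [hR]
    rw [real_inner_comm (E_t 0), real_inner_comm (H 0), real_inner_comm (j 0)]
    linarith
  have hRt : R t = 0 := by
    have e := (dR.integral_norm_sq ht).2
    -- Uniqueness for the linear equation: R² has derivative -(2/τ)R² ≤ 0 and starts at 0.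
    have hle : ∫ s in (0 : ℝ)..t, 2 * (inner ℝ (-τ⁻¹ * R s) (R s) : ℝ) ≤ 0 := by
      have : ∫ s in (0 : ℝ)..t, 2 * (inner ℝ (-τ⁻¹ * R s) (R s) : ℝ)
          = -∫ s in (0 : ℝ)..t, 2 * τ⁻¹ * R s ^ 2 := by
        rw [← intervalIntegral.integral_neg]
        refine integral_congr fun s _ => ?_
        simp
        ring
      rw [this, neg_nonpos]
      exact integral_nonneg ht.1 fun s _ => by positivity
    rw [e, hR0] at hle
    have : ‖R t‖ ^ 2 ≤ 0 := by simpa using hle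
    simpa using this
  simp only [hR] at hRt
  rw [real_inner_comm (E_t t), real_inner_comm (H t), real_inner_comm (j t)] at hRt
  linarith

/-- The energy estimate for the time derivatives, at times before `T`. -/
theorem deriv_energy_le_of_lt
    (h : IsAbstractSolution V T ε μ τ σ E E_t E_tt c H H_t K K_t g j j_t)
    (hμ : 0 < μ) (hτ : 0 < τ) (hσ : 0 < σ) {t : ℝ} (ht : t ∈ Ico 0 T) :
    ε * ‖E_t t‖ ^ 2 + μ * ‖H_t t‖ ^ 2 + τ / σ * ‖j_t t‖ ^ 2
      ≤ ε * ‖E_t 0‖ ^ 2 + μ * ‖H_t 0‖ ^ 2 + τ / σ * ‖j_t 0‖ ^ 2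
        + (4 * μ * (∫ s in (0 : ℝ)..t, ‖H_t s‖ ^ 2)
          + 1 / (4 * μ) * ∫ s in (0 : ℝ)..t, ‖K_t s‖ ^ 2) := by
  obtain ⟨F, hF, hFle⟩ := h.deriv_H.exists_bound_integral_sq_shift ht
  obtain ⟨F', hF', hFle'⟩ := h.deriv_K.exists_bound_integral_sq_shift ht
  have hT : 0 < T := ht.1.trans_lt ht.2
  have lim : ∀ r ∈ Ico 0 T, Tendsto (fun δ : ℝ => ε * ‖δ⁻¹ • (E (r + δ) - E r)‖ ^ 2
      + μ * ‖δ⁻¹ • (H (r + δ) - H r)‖ ^ 2 + τ / σ * ‖δ⁻¹ • (j (r + δ) - j r)‖ ^ 2) (𝓝[>] 0)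
      (𝓝 (ε * ‖E_t r‖ ^ 2 + μ * ‖H_t r‖ ^ 2 + τ / σ * ‖j_t r‖ ^ 2)) := fun r hr =>
    ((((h.deriv_E.tendsto_slope h.deriv_E_t.continuousOn hr).norm.pow 2).const_mul ε).add
      (((h.deriv_H.tendsto_slope (h.continuous_H_t hμ) hr).norm.pow 2).const_mul μ)).add
      (((h.deriv_j.tendsto_slope (h.continuous_j_t hτ) hr).norm.pow 2).const_mul (τ / σ))
  refine le_of_tendsto_of_tendsto (lim t ht) ((lim 0 ⟨le_rfl, hT⟩).add
    ((hF.const_mul (4 * μ)).add (hF'.const_mul (1 / (4 * μ))))) ?_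
  filter_upwards [Ioc_mem_nhdsGT (sub_pos.2 ht.2)] with δ hδ
  have hδ0 : 0 < δ := hδ.1
  have hδT : δ ≤ T := by linarith [hδ.2, ht.1]
  have htδ : t ∈ Icc 0 (T - δ) := ⟨ht.1, by linarith [hδ.2]⟩
  have hmem : ∀ r ∈ Icc 0 (T - δ), r ∈ Icc 0 T ∧ r + δ ∈ Icc 0 T := fun r hr =>
    ⟨⟨hr.1, by linarith [hr.2]⟩, by linarith [hr.1], by linarith [hr.2]⟩
  have dH : HasTimeDeriv (T - δ) (fun r => H (r + δ) - H r) (fun r => H_t (r + δ) - H_t r) :=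
    (h.deriv_H.comp_shift hδ0.le hδT).sub (h.deriv_H.mono (by linarith))
  have dK : HasTimeDeriv (T - δ) (fun r => K (r + δ) - K r) (fun r => K_t (r + δ) - K_t r) :=
    (h.deriv_K.comp_shift hδ0.le hδT).sub (h.deriv_K.mono (by linarith))
  have dj : HasTimeDeriv (T - δ) (fun r => j (r + δ) - j r) (fun r => j_t (r + δ) - j_t r) :=
    (h.deriv_j.comp_shift hδ0.le hδT).sub (h.deriv_j.mono (by linarith))
  -- Increments solve the same first order system. Its electric equation is obtained by testing
  -- `first_order` at the times r + δ and r with the same field E(r + δ) - E(r).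
  have bal := energy_balance (ε := ε) (μ := μ) (τ := τ) hσ
    (c := fun r => c (r + δ) - c r) (K := fun r => K (r + δ) - K r)
    (g := fun r => g (r + δ) - g r)
    ((h.deriv_E.comp_shift hδ0.le hδT).sub (h.deriv_E.mono (by linarith))) dH dj
    (fun r hr => by
      obtain ⟨h1, h2⟩ := hmem r hr
      have hp := h.sub_mem _ (h.mem _ h2) _ (h.mem _ h1)
      have e1 := h.first_order hμ hτ hp h1
      have e2 := h.first_order hμ hτ hp h2
      simp only [Prod.mk_sub_mk] at e1 e2
      rw [inner_sub_left, inner_sub_left (H _), inner_sub_left (j _)]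
      linear_combination e2 - e1)
    (fun r hr => by
      obtain ⟨h1, h2⟩ := hmem r hr
      rw [smul_sub, h.magnetic _ h1, h.magnetic _ h2]
      abel)
    (fun r hr => by
      obtain ⟨h1, h2⟩ := hmem r hr
      rw [smul_sub, smul_sub, ← h.current _ h1, ← h.current _ h2]
      abel) htδ
  have h0δ : (0 : ℝ) ∈ Icc 0 (T - δ) := ⟨le_rfl, htδ.1.trans htδ.2⟩
  have iH : IntervalIntegrable (fun r => ‖H (r + δ) - H r‖ ^ 2) volume 0 t :=
    intervalIntegrable_of_continuousOn (dH.continuousOn.norm.pow 2) h0δ htδ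
  have iK : IntervalIntegrable (fun r => ‖K (r + δ) - K r‖ ^ 2) volume 0 t :=
    intervalIntegrable_of_continuousOn (dK.continuousOn.norm.pow 2) h0δ htδ
  have ij : IntervalIntegrable (fun r => -(2 / σ) * ‖j (r + δ) - j r‖ ^ 2
      - 2 * inner ℝ (H (r + δ) - H r) (K (r + δ) - K r)) volume 0 t :=
    intervalIntegrable_of_continuousOn (((dj.continuousOn.norm.pow 2).const_mul _).sub
      ((dH.continuousOn.inner dK.continuousOn).const_mul _)) h0δ htδ
  have hint : ∫ s in (0 : ℝ)..t, (-(2 / σ) * ‖j (s + δ) - j s‖ ^ 2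
        - 2 * inner ℝ (H (s + δ) - H s) (K (s + δ) - K s))
      ≤ ∫ s in (0 : ℝ)..t, (4 * μ * ‖H (s + δ) - H s‖ ^ 2
        + 1 / (4 * μ) * ‖K (s + δ) - K s‖ ^ 2) := by
    refine integral_mono_on ht.1 ij ((iH.const_mul _).add (iK.const_mul _)) fun s _ => ?_
    have h1 : 0 ≤ 2 / σ * ‖j (s + δ) - j s‖ ^ 2 := by positivity
    have h2 := neg_le_of_abs_le (abs_real_inner_le_norm (H (s + δ) - H s) (K (s + δ) - K s))
    -- Young's inequality with weight 4μ: after the later factor 2τ the source costs τ/(2μ)‖∂_tK‖²,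
    -- half of what the final estimate allows, and the rest is 8τμ‖∂_tH‖².
    have h3 : 2 * (‖H (s + δ) - H s‖ * ‖K (s + δ) - K s‖) ≤ 4 * μ * ‖H (s + δ) - H s‖ ^ 2
        + 1 / (4 * μ) * ‖K (s + δ) - K s‖ ^ 2 := by
      have e : 4 * μ * ‖H (s + δ) - H s‖ ^ 2 + 1 / (4 * μ) * ‖K (s + δ) - K s‖ ^ 2
          - 2 * (‖H (s + δ) - H s‖ * ‖K (s + δ) - K s‖)
          = (4 * μ * ‖H (s + δ) - H s‖ - ‖K (s + δ) - K s‖) ^ 2 / (4 * μ) := by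
        field_simp
        ring
      have : 0 ≤ (4 * μ * ‖H (s + δ) - H s‖ - ‖K (s + δ) - K s‖) ^ 2 / (4 * μ) := by positivity
      linarith
    linarith
  rw [integral_add (iH.const_mul _) (iK.const_mul _), intervalIntegral.integral_const_mul,
    intervalIntegral.integral_const_mul] at hint
  have hH := mul_le_mul_of_nonneg_left (hFle δ hδ0 hδ.2) (show 0 ≤ 4 * μ by positivity)
  have hK := mul_le_mul_of_nonneg_left (hFle' δ hδ0 hδ.2) (show 0 ≤ 1 / (4 * μ) by positivity)
  have hδ2 : 0 < δ ^ 2 := by positivity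
  refine le_of_mul_le_mul_left ?_ hδ2
  simp only [norm_smul, mul_pow, norm_inv, inv_pow, Real.norm_eq_abs, sq_abs]
  have hc : ∀ a b : ℝ, δ ^ 2 * (a * ((δ ^ 2)⁻¹ * b)) = a * b := fun a b => by field_simp
  simp only [mul_add, hc]
  simp only [zero_add] at bal
  simp only [zero_add]
  linarith

/-- The energy estimate for the time derivatives. -/
theorem deriv_energy_le
    (h : IsAbstractSolution V T ε μ τ σ E E_t E_tt c H H_t K K_t g j j_t)
    (hT : 0 < T) (hμ : 0 < μ) (hτ : 0 < τ) (hσ : 0 < σ) {t : ℝ} (ht : t ∈ Icc 0 T) :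
    ε * ‖E_t t‖ ^ 2 + μ * ‖H_t t‖ ^ 2 + τ / σ * ‖j_t t‖ ^ 2
      ≤ ε * ‖E_t 0‖ ^ 2 + μ * ‖H_t 0‖ ^ 2 + τ / σ * ‖j_t 0‖ ^ 2
        + (4 * μ * (∫ s in (0 : ℝ)..t, ‖H_t s‖ ^ 2)
          + 1 / (4 * μ) * ∫ s in (0 : ℝ)..t, ‖K_t s‖ ^ 2) := by
  have h0 : (0 : ℝ) ∈ Icc 0 T := ⟨le_rfl, hT.le⟩
  have hTT : T ∈ Icc 0 T := ⟨hT.le, le_rfl⟩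
  have prim : ∀ {f : ℝ → ℝ}, IntervalIntegrable f volume 0 T →
      ContinuousOn (fun r => ∫ s in (0 : ℝ)..r, f s) (Icc 0 T) := fun hf => by
    have := continuousOn_primitive_interval' hf left_mem_uIcc
    rwa [uIcc_of_le hT.le] at this
  have cl : ContinuousOn (fun t => ε * ‖E_t t‖ ^ 2 + μ * ‖H_t t‖ ^ 2 + τ / σ * ‖j_t t‖ ^ 2)
      (Icc 0 T) :=
    (((h.deriv_E_t.continuousOn.norm.pow 2).const_mul ε).add
      (((h.continuous_H_t hμ).norm.pow 2).const_mul μ)).add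
      (((h.continuous_j_t hτ).norm.pow 2).const_mul (τ / σ))
  have cr : ContinuousOn (fun t => ε * ‖E_t 0‖ ^ 2 + μ * ‖H_t 0‖ ^ 2 + τ / σ * ‖j_t 0‖ ^ 2
        + (4 * μ * (∫ s in (0 : ℝ)..t, ‖H_t s‖ ^ 2)
          + 1 / (4 * μ) * ∫ s in (0 : ℝ)..t, ‖K_t s‖ ^ 2)) (Icc 0 T) :=
    continuousOn_const.add
      (((prim (intervalIntegrable_sq_of_memLp h.deriv_H.1 h0 hTT)).const_mul _).add
        ((prim (intervalIntegrable_sq_of_memLp h.deriv_K.1 h0 hTT)).const_mul _))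
  have hcl : closure (Ico 0 T) = Icc 0 T := closure_Ico hT.ne
  rw [← hcl] at cl cr ht
  -- Forward difference quotients do not exist at T, so that endpoint is reached by continuity of
  -- both sides.
  exact le_on_closure (fun r hr => h.deriv_energy_le_of_lt hμ hτ hσ hr) cl cr ht

end IsAbstractSolution

end AbstractSystem

/-! ### The energy estimate in abstract form. -/

section AbstractEnergy

open intervalIntegral Filter Topology

variable {A B G : Type*} [NormedAddCommGroup A] [InnerProductSpace ℝ A]
  [NormedAddCommGroup B] [InnerProductSpace ℝ B] [NormedAddCommGroup G] [InnerProductSpace ℝ G]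

/-- The energy in abstract Hilbert spaces. -/
noncomputable def abstractEnergy (ε μ τ σ : ℝ) (E E_t : ℝ → A) (H H_t : ℝ → B) (g j j_t : ℝ → G) (t : ℝ) : ℝ :=
  2 * τ * ε * ‖E_t t‖ ^ 2 + σ * ‖g t‖ ^ 2 + μ * ‖√τ • H_t t + (√τ)⁻¹ • H t‖ ^ 2
    + μ / τ * ‖H t‖ ^ 2 + 2 * ε / τ * ‖E t‖ ^ 2 + 2 / σ * ‖j t‖ ^ 2
    + τ * μ * ‖H_t t‖ ^ 2 + τ ^ 2 / σ * ‖j_t t‖ ^ 2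

namespace IsAbstractSolution

variable {V : Set (A × B × G)} {T ε μ τ σ : ℝ} {E E_t E_tt : ℝ → A}
  {c H H_t K K_t : ℝ → B} {g j j_t : ℝ → G}

theorem continuous_energy
    (h : IsAbstractSolution V T ε μ τ σ E E_t E_tt c H H_t K K_t g j j_t)
    (hμ : 0 < μ) (hτ : 0 < τ) :
    ContinuousOn (abstractEnergy ε μ τ σ E E_t H H_t g j j_t) (Icc 0 T) := by
  have c1 := h.deriv_E_t.continuousOn
  have c2 := h.deriv_E.continuousOn
  have c3 := h.deriv_H.continuousOn
  have c4 := h.continuous_H_t hμ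
  have c5 := h.deriv_j.continuousOn
  have c6 := h.continuous_j_t hτ
  have c7 := h.continuous_g
  unfold abstractEnergy
  fun_prop

variable [CompleteSpace A] [CompleteSpace B] [CompleteSpace G]

/-- Expanding the squares σ‖g‖² = σ⁻¹‖τ∂_tj + j‖² and μ‖√τ ∂_tH + H/√τ‖² leaves the mixed products
(2τ/σ)(∂_tj, j) and 2μ(∂_tH, H). The first order equation tested with E, together with the magnetic
equation, turns these into the cross term. -/
theorem energy_eq (h : IsAbstractSolution V T ε μ τ σ E E_t E_tt c H H_t K K_t g j j_t)
    (hμ : 0 < μ) (hτ : 0 < τ) (hσ : 0 < σ) {t : ℝ} (ht : t ∈ Icc 0 T) :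
    abstractEnergy ε μ τ σ E E_t H H_t g j j_t t
      = 2 * τ * (ε * ‖E_t t‖ ^ 2 + μ * ‖H_t t‖ ^ 2 + τ / σ * ‖j_t t‖ ^ 2)
        + 2 / τ * (ε * ‖E t‖ ^ 2 + μ * ‖H t‖ ^ 2 + τ / σ * ‖j t‖ ^ 2)
        - 1 / σ * ‖j t‖ ^ 2 - 2 * (ε * inner ℝ (E_t t) (E t) + inner ℝ (H t) (K t)) := by
  have h1 := h.first_order hμ hτ (h.mem t ht) ht
  have h2 := congrArg (fun x => (inner ℝ x (H t) : ℝ)) (h.magnetic t ht)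
  have hg : g t = σ⁻¹ • (τ • j_t t + j t) := by rw [h.current t ht, inv_smul_smul₀ hσ.ne']
  have hs : √τ ^ 2 = τ := Real.sq_sqrt hτ.le
  have hs0 : √τ ≠ 0 := (Real.sqrt_pos.2 hτ).ne'
  simp only at h1
  rw [hg] at h1
  unfold abstractEnergy
  rw [hg, norm_smul, mul_pow, norm_add_sq_real, norm_add_sq_real]
  simp only [inner_smul_left, inner_smul_right, inner_sub_left, inner_add_right, inner_neg_left,
    real_inner_self_eq_norm_sq, conj_trivial, norm_smul, mul_pow, norm_inv, inv_pow,
    Real.norm_eq_abs, sq_abs, hs] at h1 h2 ⊢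
  rw [real_inner_comm (j_t t)] at h1
  rw [h1, real_inner_comm (K t), real_inner_comm (c t), inv_mul_cancel_left₀ hs0]
  field_simp
  linear_combination 2 * σ * τ * h2

/-- The cross term of the energy is absolutely continuous, with the expected derivative. -/
theorem integral_cross_term
    (h : IsAbstractSolution V T ε μ τ σ E E_t E_tt c H H_t K K_t g j j_t)
    (hμ : 0 < μ) (hτ : 0 < τ) {t : ℝ} (ht : t ∈ Icc 0 T) :
    ε * inner ℝ (E_t t) (E t) + inner ℝ (H t) (K t)
      = ε * inner ℝ (E_t 0) (E 0) + inner ℝ (H 0) (K 0)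
        + ∫ s in (0 : ℝ)..t, (ε * ‖E_t s‖ ^ 2 - μ * ‖H_t s‖ ^ 2 - inner ℝ (j_t s) (g s)
          + inner ℝ (H s) (K_t s)) := by
  obtain ⟨i1, e1⟩ := h.deriv_E_t.integral_inner h.deriv_E ht
  obtain ⟨i2, e2⟩ := h.deriv_H.integral_inner h.deriv_K ht
  have key : ∫ s in (0 : ℝ)..t, (ε * ‖E_t s‖ ^ 2 - μ * ‖H_t s‖ ^ 2 - inner ℝ (j_t s) (g s)
          + inner ℝ (H s) (K_t s))
      = ∫ s in (0 : ℝ)..t, (ε * (inner ℝ (E_tt s) (E s) + inner ℝ (E_t s) (E_t s))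
        + (inner ℝ (H_t s) (K s) + inner ℝ (H s) (K_t s))) := by
    refine integral_congr_ae_restrict ?_
    rw [uIoc_of_le ht.1]
    have hsub : Ioc 0 t ⊆ Icc 0 T := Ioc_subset_Icc_self.trans (Icc_subset_Icc_right ht.2)
    filter_upwards [ae_restrict_of_ae_restrict_of_subset hsub h.electric,
      ae_restrict_mem measurableSet_Ioc] with s hs hsm
    have hsT := hsub hsm
    have h1 := hs _ (h.mem s hsT)
    have h2 := h.first_order hμ hτ (h.mem s hsT) hsT
    have h3 := congrArg (fun x => (inner ℝ x (c s) : ℝ)) (h.magnetic s hsT)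
    have h4 := congrArg (fun x => (inner ℝ x (g s) : ℝ)) (h.current s hsT)
    have h5 := congrArg (fun x => (inner ℝ x (H_t s) : ℝ)) (h.magnetic s hsT)
    simp only [inner_smul_left, inner_sub_left, inner_add_left, inner_neg_left,
      real_inner_self_eq_norm_sq, conj_trivial] at h1 h2 h3 h4 h5 ⊢
    rw [real_inner_comm (H_t s) (c s), real_inner_comm (H_t s) (K s)] at h5
    -- The electric equation tested with E, minus its first order form, is the time-differentiated
    -- first order equation tested with E; no regularity of ∂_tE in V is needed.
    have h6 : τ * (ε * inner ℝ (E_tt s) (E s))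
        = τ * (inner ℝ (H_t s) (c s) - inner ℝ (j_t s) (g s)) := by
      field_simp at h1
      apply mul_left_cancel₀ hμ.ne'
      linear_combination h1 - μ * h2 - τ * h3 + μ * h4
    have h7 := mul_left_cancel₀ hτ.ne' h6
    linear_combination -h7 - h5
  rw [key, integral_add (i1.const_mul ε) i2, intervalIntegral.integral_const_mul, e1, e2]
  ring

/-- The two energy balances and the cross term are inserted into `energy_eq`, and the integrands are
compared pointwise. The constant 8 comes from 8τμ‖∂_tH‖² in the derivative energy; 2/τ comes from
the cross term's contributions 2μ‖∂_tH‖² and (2τ/σ)‖∂_tj‖². -/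
theorem energy_le_add_integral
    (h : IsAbstractSolution V T ε μ τ σ E E_t E_tt c H H_t K K_t g j j_t)
    (hT : 0 < T) (hε : 0 < ε) (hμ : 0 < μ) (hτ : 0 < τ) (hσ : 0 < σ) {t : ℝ} (ht : t ∈ Icc 0 T) :
    abstractEnergy ε μ τ σ E E_t H H_t g j j_t t
      ≤ abstractEnergy ε μ τ σ E E_t H H_t g j j_t 0
        + ∫ s in (0 : ℝ)..t, ((τ / μ * ‖K_t s‖ ^ 2 + 1 / (τ * μ) * ‖K s‖ ^ 2)
          + (8 + 2 / τ) * abstractEnergy ε μ τ σ E E_t H H_t g j j_t s) := by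
  have h0 : (0 : ℝ) ∈ Icc 0 T := ⟨le_rfl, hT.le⟩
  have b0 := energy_balance (ε := ε) (μ := μ) (τ := τ) hσ h.deriv_E h.deriv_H h.deriv_j
    (fun r hr => h.first_order hμ hτ (h.mem r hr) hr) h.magnetic h.current ht
  have b1 := h.deriv_energy_le hT hμ hτ hσ ht
  have b2 := h.integral_cross_term hμ hτ ht
  obtain ⟨ij, ej⟩ := h.deriv_j.integral_norm_sq ht
  rw [h.energy_eq hμ hτ hσ ht, h.energy_eq hμ hτ hσ h0]
  have ic : ∀ {f : ℝ → ℝ}, ContinuousOn f (Icc 0 T) → IntervalIntegrable f volume 0 t :=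
    fun hf => intervalIntegrable_of_continuousOn hf h0 ht
  have cHt := h.continuous_H_t hμ
  have cjt := h.continuous_j_t hτ
  have cH := h.deriv_H.continuousOn
  have cK := h.deriv_K.continuousOn
  have cj := h.deriv_j.continuousOn
  have cg := h.continuous_g
  have cEt := h.deriv_E_t.continuousOn
  have iHt : IntervalIntegrable (fun s => ‖H_t s‖ ^ 2) volume 0 t := ic (cHt.norm.pow 2)
  have iK2 : IntervalIntegrable (fun s => ‖K s‖ ^ 2) volume 0 t := ic (cK.norm.pow 2)
  have iKt : IntervalIntegrable (fun s => ‖K_t s‖ ^ 2) volume 0 t :=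
    intervalIntegrable_sq_of_memLp h.deriv_K.1 h0 ht
  have iA : IntervalIntegrable (fun s => -(2 / σ) * ‖j s‖ ^ 2 - 2 * inner ℝ (H s) (K s))
      volume 0 t := ic (by fun_prop)
  have iHK : IntervalIntegrable (fun s => (inner ℝ (H s) (K_t s) : ℝ)) volume 0 t := by
    have := intervalIntegrable_inner (intervalIntegrable_of_memLp h.deriv_K.1 h0 ht)
      (cH.mono (uIcc_subset_Icc h0 ht))
    simpa only [real_inner_comm] using this
  have iP : IntervalIntegrable (fun s => ε * ‖E_t s‖ ^ 2 - μ * ‖H_t s‖ ^ 2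
      - inner ℝ (j_t s) (g s) + inner ℝ (H s) (K_t s)) volume 0 t :=
    (ic (f := fun s => ε * ‖E_t s‖ ^ 2 - μ * ‖H_t s‖ ^ 2 - inner ℝ (j_t s) (g s))
      (by fun_prop)).add iHK
  have iEn := ic (h.continuous_energy hμ hτ)
  set A₁ := ∫ s in (0 : ℝ)..t, ‖H_t s‖ ^ 2
  set A₂ := ∫ s in (0 : ℝ)..t, ‖K_t s‖ ^ 2
  set A₃ := ∫ s in (0 : ℝ)..t, (-(2 / σ) * ‖j s‖ ^ 2 - 2 * inner ℝ (H s) (K s)) with hA₃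
  set A₄ := ∫ s in (0 : ℝ)..t, (ε * ‖E_t s‖ ^ 2 - μ * ‖H_t s‖ ^ 2
      - inner ℝ (j_t s) (g s) + inner ℝ (H s) (K_t s)) with hA₄
  set A₅ := ∫ s in (0 : ℝ)..t, 2 * (inner ℝ (j_t s) (j s) : ℝ)
  have key : 2 * τ * (4 * μ * A₁ + 1 / (4 * μ) * A₂) + 2 / τ * A₃ - 1 / σ * A₅ - 2 * A₄
      ≤ ∫ s in (0 : ℝ)..t, ((τ / μ * ‖K_t s‖ ^ 2 + 1 / (τ * μ) * ‖K s‖ ^ 2)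
          + (8 + 2 / τ) * abstractEnergy ε μ τ σ E E_t H H_t g j j_t s) := by
    have e : ∫ s in (0 : ℝ)..t, (2 * τ * (4 * μ * ‖H_t s‖ ^ 2 + 1 / (4 * μ) * ‖K_t s‖ ^ 2)
        + 2 / τ * (-(2 / σ) * ‖j s‖ ^ 2 - 2 * inner ℝ (H s) (K s))
        - 1 / σ * (2 * inner ℝ (j_t s) (j s))
        - 2 * (ε * ‖E_t s‖ ^ 2 - μ * ‖H_t s‖ ^ 2 - inner ℝ (j_t s) (g s)
          + inner ℝ (H s) (K_t s)))
        = 2 * τ * (4 * μ * A₁ + 1 / (4 * μ) * A₂) + 2 / τ * A₃ - 1 / σ * A₅ - 2 * A₄ := by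
      have iB := ((iHt.const_mul (4 * μ)).add (iKt.const_mul (1 / (4 * μ)))).const_mul (2 * τ)
      rw [integral_sub ((iB.add (iA.const_mul _)).sub (ij.const_mul _)) (iP.const_mul _),
        integral_sub (iB.add (iA.const_mul _)) (ij.const_mul _),
        integral_add iB (iA.const_mul _), intervalIntegral.integral_const_mul,
        integral_add (iHt.const_mul _) (iKt.const_mul _),
        intervalIntegral.integral_const_mul _ (fun s => ‖H_t s‖ ^ 2),
        intervalIntegral.integral_const_mul _ (fun s => ‖K_t s‖ ^ 2),
        intervalIntegral.integral_const_mul _ (fun s => -(2 / σ) * ‖j s‖ ^ 2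
          - 2 * (inner ℝ (H s) (K s) : ℝ)),
        intervalIntegral.integral_const_mul _ (fun s => 2 * (inner ℝ (j_t s) (j s) : ℝ)),
        intervalIntegral.integral_const_mul _ (fun s => ε * ‖E_t s‖ ^ 2 - μ * ‖H_t s‖ ^ 2
          - (inner ℝ (j_t s) (g s) : ℝ) + (inner ℝ (H s) (K_t s) : ℝ))]
    rw [← e]
    refine integral_mono_on ht.1 ?_ ?_ fun s hs => ?_
    · exact (((((iHt.const_mul (4 * μ)).add (iKt.const_mul (1 / (4 * μ)))).const_mul
        (2 * τ)).add (iA.const_mul _)).sub (ij.const_mul _)).sub (iP.const_mul _)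
    · exact ((iKt.const_mul _).add (iK2.const_mul _)).add (iEn.const_mul _)
    have hsT : s ∈ Icc 0 T := ⟨hs.1, hs.2.trans ht.2⟩
    have hg : g s = σ⁻¹ • (τ • j_t s + j s) := by
      rw [h.current s hsT, inv_smul_smul₀ hσ.ne']
    -- The product (∂_tj, j) arising here cancels the one from the derivative of -(1/σ)‖j‖².
    have hgj : (inner ℝ (j_t s) (g s) : ℝ)
        = τ / σ * ‖j_t s‖ ^ 2 + 1 / σ * inner ℝ (j_t s) (j s) := by
      rw [hg]
      simp only [inner_smul_right, inner_add_right, real_inner_self_eq_norm_sq]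
      field_simp
    have hlow : τ * μ * ‖H_t s‖ ^ 2 + τ ^ 2 / σ * ‖j_t s‖ ^ 2 + μ / τ * ‖H s‖ ^ 2
        ≤ abstractEnergy ε μ τ σ E E_t H H_t g j j_t s := by
      unfold abstractEnergy
      have : 0 ≤ 2 * τ * ε * ‖E_t s‖ ^ 2 := by positivity
      have : 0 ≤ σ * ‖g s‖ ^ 2 := by positivity
      have : 0 ≤ μ * ‖√τ • H_t s + (√τ)⁻¹ • H s‖ ^ 2 := by positivity
      have : 0 ≤ 2 * ε / τ * ‖E s‖ ^ 2 := by positivity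
      have : 0 ≤ 2 / σ * ‖j s‖ ^ 2 := by positivity
      linarith
    have hE' : (8 + 2 / τ) * (τ * μ * ‖H_t s‖ ^ 2 + τ ^ 2 / σ * ‖j_t s‖ ^ 2 + μ / τ * ‖H s‖ ^ 2)
        ≤ (8 + 2 / τ) * abstractEnergy ε μ τ σ E E_t H H_t g j j_t s := by gcongr
    -- The Young weights here and in `hHKt` produce exactly the coefficient of ‖K‖² and the missing
    -- half of that of ‖∂_tK‖². The cost is (4 + 2)(μ/τ)‖H‖², within the available 8(μ/τ)‖H‖².
    have hHK : -(4 / τ) * (inner ℝ (H s) (K s) : ℝ)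
        ≤ 4 * (μ / τ) * ‖H s‖ ^ 2 + 1 / (τ * μ) * ‖K s‖ ^ 2 := by
      have h1 := neg_le_of_abs_le (abs_real_inner_le_norm (H s) (K s))
      have h2 : 0 ≤ (2 * μ * ‖H s‖ - ‖K s‖) ^ 2 / (τ * μ) := by positivity
      have h3 : (2 * μ * ‖H s‖ - ‖K s‖) ^ 2 / (τ * μ) = 4 * (μ / τ) * ‖H s‖ ^ 2
          + 1 / (τ * μ) * ‖K s‖ ^ 2 - 4 / τ * (‖H s‖ * ‖K s‖) := by field_simp; ring
      have h4 : 4 / τ * -(inner ℝ (H s) (K s) : ℝ) ≤ 4 / τ * (‖H s‖ * ‖K s‖) := by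
        gcongr; linarith
      linarith
    have hHKt : -2 * (inner ℝ (H s) (K_t s) : ℝ)
        ≤ 2 * (μ / τ) * ‖H s‖ ^ 2 + τ / (2 * μ) * ‖K_t s‖ ^ 2 := by
      have h1 := neg_le_of_abs_le (abs_real_inner_le_norm (H s) (K_t s))
      have h2 : 0 ≤ (2 * μ * ‖H s‖ - τ * ‖K_t s‖) ^ 2 / (2 * τ * μ) := by positivity
      have h3 : (2 * μ * ‖H s‖ - τ * ‖K_t s‖) ^ 2 / (2 * τ * μ) = 2 * (μ / τ) * ‖H s‖ ^ 2
          + τ / (2 * μ) * ‖K_t s‖ ^ 2 - 2 * (‖H s‖ * ‖K_t s‖) := by field_simp; ring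
      linarith
    rw [hgj]
    have p1 : 0 ≤ ε * ‖E_t s‖ ^ 2 := by positivity
    have p2 : 0 ≤ 4 / (τ * σ) * ‖j s‖ ^ 2 := by positivity
    have p3 : 0 ≤ τ ^ 2 / σ * ‖j_t s‖ ^ 2 := by positivity
    have p4 : 0 ≤ μ / τ * ‖H s‖ ^ 2 := by positivity
    have p5 : 0 ≤ 2 / τ * (μ / τ * ‖H s‖ ^ 2) := by positivity
    have q1 : (8 + 2 / τ) * (τ * μ * ‖H_t s‖ ^ 2 + τ ^ 2 / σ * ‖j_t s‖ ^ 2 + μ / τ * ‖H s‖ ^ 2)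
        = 8 * (τ * μ * ‖H_t s‖ ^ 2) + 2 * (μ * ‖H_t s‖ ^ 2) + 8 * (τ ^ 2 / σ * ‖j_t s‖ ^ 2)
          + 2 * (τ / σ * ‖j_t s‖ ^ 2) + 8 * (μ / τ * ‖H s‖ ^ 2)
          + 2 / τ * (μ / τ * ‖H s‖ ^ 2) := by
      field_simp
      ring
    have q2 : 2 * τ * (4 * μ * ‖H_t s‖ ^ 2 + 1 / (4 * μ) * ‖K_t s‖ ^ 2)
        = 8 * (τ * μ * ‖H_t s‖ ^ 2) + τ / (2 * μ) * ‖K_t s‖ ^ 2 := by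
      field_simp
      ring
    have q3 : 2 / τ * (-(2 / σ) * ‖j s‖ ^ 2 - 2 * inner ℝ (H s) (K s))
        = -(4 / (τ * σ) * ‖j s‖ ^ 2) + -(4 / τ) * inner ℝ (H s) (K s) := by
      field_simp
      ring
    have q4 : τ / μ * ‖K_t s‖ ^ 2 = 2 * (τ / (2 * μ) * ‖K_t s‖ ^ 2) := by
      field_simp
    have q5 : 1 / σ * (2 * (inner ℝ (j_t s) (j s) : ℝ)) = 2 * (1 / σ * inner ℝ (j_t s) (j s)) := by
      ring
    rw [q2, q3, q4, q5]
    linarith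
  have b1' := mul_le_mul_of_nonneg_left b1 (show 0 ≤ 2 * τ by positivity)
  rw [b0, b2]
  have ej' : 1 / σ * ‖j t‖ ^ 2 = 1 / σ * ‖j 0‖ ^ 2 + 1 / σ * A₅ := by rw [ej]; ring
  rw [ej']
  linarith

/-- The energy estimate. -/
theorem energy_le (h : IsAbstractSolution V T ε μ τ σ E E_t E_tt c H H_t K K_t g j j_t)
    (hT : 0 < T) (hε : 0 < ε) (hμ : 0 < μ) (hτ : 0 < τ) (hσ : 0 < σ) {t : ℝ} (ht : t ∈ Icc 0 T) :
    abstractEnergy ε μ τ σ E E_t H H_t g j j_t t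
      ≤ (abstractEnergy ε μ τ σ E E_t H H_t g j j_t 0
        + ∫ s in (0 : ℝ)..t, (τ / μ * ‖K_t s‖ ^ 2 + 1 / (τ * μ) * ‖K s‖ ^ 2))
        * Real.exp ((8 + 2 / τ) * t) := by
  have h0 : (0 : ℝ) ∈ Icc 0 T := ⟨le_rfl, hT.le⟩
  refine le_mul_exp_of_le_add_integral (by positivity) (h.continuous_energy hμ hτ)
    (fun s _ => by positivity) (fun r hr => ?_)
    (fun r hr => h.energy_le_add_integral hT hε hμ hτ hσ hr) ht
  exact ((intervalIntegrable_sq_of_memLp h.deriv_K.1 h0 hr).const_mul _).add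
    ((intervalIntegrable_of_continuousOn (h.deriv_K.continuousOn.norm.pow 2) h0 hr).const_mul _)

end IsAbstractSolution

end AbstractEnergy

/-! ### Tangential parts of sheet currents. -/

section Sheet

variable {Ω Γ : Set Plane} {n : Plane → Plane}

theorem IsSheet.measurableSet (h : IsSheet Ω Γ n) : MeasurableSet Γ := by
  obtain ⟨k, γ, hd, -, -, -, -, hΓ, -⟩ := h.arcs
  rw [hΓ]
  exact MeasurableSet.iUnion fun i =>
    (isCompact_Icc.image_of_continuousOn (hd i).continuousOn).isClosed.measurableSet

/-- The normal of a sheet has length one almost everywhere, because end points are null sets. -/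
theorem IsSheet.ae_norm_eq_one (h : IsSheet Ω Γ n) : ∀ᵐ x ∂(arcLength Γ), ‖n x‖ = 1 := by
  have hm := h.measurableSet
  obtain ⟨k, γ, -, -, -, -, -, hΓ, hn⟩ := h.arcs
  have : NullSingletonClass (Measure.hausdorffMeasure 1 : Measure Plane) :=
    Measure.nullSingletonClass_hausdorff Plane one_pos
  have hS : (⋃ i, {γ i 0, γ i 1}).Countable :=
    countable_iUnion fun i => (Set.toFinite _).countable
  rw [ae_restrict_iff' hm]
  filter_upwards [hS.ae_notMem (Measure.hausdorffMeasure 1)] with x hx hxΓ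
  rw [hΓ, mem_iUnion] at hxΓ
  obtain ⟨i, s, hs, rfl⟩ := hxΓ
  have hne : γ i s ≠ γ i 0 ∧ γ i s ≠ γ i 1 := by
    refine ⟨fun e => hx ?_, fun e => hx ?_⟩ <;> rw [e] <;> exact mem_iUnion.2 ⟨i, by simp⟩
  refine (hn i s ⟨lt_of_le_of_ne hs.1 ?_, lt_of_le_of_ne hs.2 ?_⟩).1
  · rintro rfl; exact hne.1 rfl
  · rintro rfl; exact hne.2 rfl

theorem abs_cross_le (a b : Plane) : |cross a b| ≤ ‖a‖ * ‖b‖ := by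
  refine abs_le_of_sq_le_sq ?_ (by positivity)
  rw [mul_pow, EuclideanSpace.real_norm_sq_eq, EuclideanSpace.real_norm_sq_eq, Fin.sum_univ_two,
    Fin.sum_univ_two, cross]
  nlinarith [sq_nonneg (a 0 * b 0 + a 1 * b 1)]

theorem aestronglyMeasurable_cross {μ : Measure Plane} {f m : Plane → Plane}
    (hf : AEStronglyMeasurable f μ) (hm : AEStronglyMeasurable m μ) :
    AEStronglyMeasurable (fun x => cross (f x) (m x)) μ := by
  have hc : Continuous fun p : Plane × Plane => cross p.1 p.2 := by
    unfold cross; fun_prop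
  exact hc.comp_aestronglyMeasurable (hf.prodMk hm)

theorem IsSheet.memLp_cross (h : IsSheet Ω Γ n) (f : L2SheetVec Γ) :
    MemLp (fun x => cross (f x) (n x)) 2 (arcLength Γ) := by
  refine (Lp.memLp f).of_le
    (aestronglyMeasurable_cross (Lp.aestronglyMeasurable f) h.measurable_normal) ?_
  filter_upwards [h.ae_norm_eq_one] with x hx
  have := abs_cross_le (f x) (n x)
  rwa [hx, mul_one] at this

/-- The tangential part `f ↦ f × n` as an operator on `L²(Γ)²`. -/
noncomputable def tangential (h : IsSheet Ω Γ n) : L2SheetVec Γ →L[ℝ] L2Sheet Γ :=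
  LinearMap.mkContinuous
    { toFun := fun f => (h.memLp_cross f).toLp
      map_add' := fun f g => by
        rw [← MemLp.toLp_add]
        refine MemLp.toLp_congr _ _ ?_
        filter_upwards [Lp.coeFn_add f g] with x hx
        simp only [Pi.add_apply, hx, cross, PiLp.add_apply]
        ring
      map_smul' := fun r f => by
        rw [RingHom.id_apply, ← MemLp.toLp_const_smul]
        refine MemLp.toLp_congr _ _ ?_
        filter_upwards [Lp.coeFn_smul r f] with x hx
        simp only [Pi.smul_apply, hx, cross, PiLp.smul_apply, smul_eq_mul]
        ring } 1 fun f => by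
    rw [one_mul]
    refine Lp.norm_le_norm_of_ae_le ?_
    filter_upwards [(h.memLp_cross f).coeFn_toLp, h.ae_norm_eq_one] with x h1 hx
    have := abs_cross_le (f x) (n x)
    rw [hx, mul_one] at this
    simp only [LinearMap.coe_mk, AddHom.coe_mk]
    rw [h1]
    exact this

theorem coeFn_tangential (h : IsSheet Ω Γ n) (f : L2SheetVec Γ) :
    tangential h f =ᵐ[arcLength Γ] fun x => cross (f x) (n x) :=
  (h.memLp_cross f).coeFn_toLp

theorem inner_tangential (h : IsSheet Ω Γ n) (f : L2SheetVec Γ) (g : L2Sheet Γ) :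
    inner ℝ (tangential h f) g = sheetInner n f g := by
  rw [L2.inner_def, sheetInner]
  refine integral_congr_ae ?_
  filter_upwards [coeFn_tangential h f] with x hx
  simp only [hx, RCLike.inner_apply, conj_trivial]
  ring

theorem inner_tangential_tangential (h : IsSheet Ω Γ n) (f g : L2SheetVec Γ) :
    inner ℝ (tangential h f) (tangential h g)
      = ∫ x, cross (f x) (n x) * cross (g x) (n x) ∂(arcLength Γ) := by
  rw [inner_tangential, sheetInner]
  refine integral_congr_ae ?_
  filter_upwards [coeFn_tangential h g] with x hx
  rw [hx]

theorem norm_tangential_sq (h : IsSheet Ω Γ n) (f : L2SheetVec Γ) :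
    ‖tangential h f‖ ^ 2 = sheetNormSq n f := by
  rw [← real_inner_self_eq_norm_sq, inner_tangential_tangential, sheetNormSq]
  simp only [pow_two]

/-- Multiplying g by the rotated normal (n_y, -n_x) gives a preimage, since its cross product with n
is |n|² = 1 almost everywhere. This makes the tested current equation an identity in L²(Γ). -/
theorem tangential_surjective (h : IsSheet Ω Γ n) : Function.Surjective (tangential h) := by
  intro g
  have hc : Continuous fun p : ℝ × Plane => p.1 • (!₂[p.2 1, -p.2 0] : Plane) := by fun_prop
  have hm : AEStronglyMeasurable (fun x => g x • (!₂[n x 1, -n x 0] : Plane)) (arcLength Γ) :=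
    hc.comp_aestronglyMeasurable ((Lp.aestronglyMeasurable g).prodMk h.measurable_normal)
  have hL : MemLp (fun x => g x • (!₂[n x 1, -n x 0] : Plane)) 2 (arcLength Γ) := by
    refine (Lp.memLp g).of_le hm ?_
    filter_upwards [h.ae_norm_eq_one] with x hx
    have e : ‖(!₂[n x 1, -n x 0] : Plane)‖ = 1 := by
      rw [← hx, EuclideanSpace.norm_eq, EuclideanSpace.norm_eq]
      simp [Fin.sum_univ_two, add_comm]
    rw [norm_smul, e, mul_one]
  refine ⟨hL.toLp, Lp.ext ?_⟩
  filter_upwards [coeFn_tangential h hL.toLp, hL.coeFn_toLp, h.ae_norm_eq_one] with x h1 h2 h3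
  rw [h1, h2]
  have e : n x 0 ^ 2 + n x 1 ^ 2 = 1 := by
    rw [← Fin.sum_univ_two (fun i => n x i ^ 2), ← EuclideanSpace.real_norm_sq_eq, h3, one_pow]
  simp only [cross, PiLp.smul_apply, smul_eq_mul, Matrix.cons_val_zero, Matrix.cons_val_one]
  simp
  linear_combination g x * e

end Sheet

/-! ### Differences of admissible fields, and transfer to the abstract system. -/

section Fields

variable {Ω Γ : Set Plane} {n : Plane → Plane}

theorem continuous_curlScalar {ψ : Plane → ℝ} (hψ : ContDiff ℝ (⊤ : ℕ∞) ψ) :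
    Continuous (curlScalar ψ) := by
  have h := hψ.continuous_fderiv (by simp)
  unfold curlScalar partialDeriv
  fun_prop

theorem hasCompactSupport_curlScalar {ψ : Plane → ℝ} (hψ : HasCompactSupport ψ) :
    HasCompactSupport (curlScalar ψ) := by
  refine (hψ.fderiv ℝ).mono fun x hx hx' => hx ?_
  ext i
  fin_cases i <;> simp [curlScalar, partialDeriv, hx']

theorem continuous_curlVector {φ : Plane → Plane} (hφ : ContDiff ℝ (⊤ : ℕ∞) φ) :
    Continuous (curlVector φ) := by
  have h := hφ.continuous_fderiv (by simp)
  unfold curlVector partialDeriv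
  fun_prop

theorem IsHZeroCurl.sub {u u' : L2Vec Ω} {c c' : L2 Ω} (h : IsHZeroCurl Ω u c)
    (h' : IsHZeroCurl Ω u' c') : IsHZeroCurl Ω (u - u') (c - c') := by
  intro ψ hψ hs
  have m1 : MemLp ψ 2 (area Ω) := hψ.continuous.memLp_of_hasCompactSupport hs
  have m2 : MemLp (curlScalar ψ) 2 (area Ω) :=
    (continuous_curlScalar hψ).memLp_of_hasCompactSupport (hasCompactSupport_curlScalar hs)
  have i1 : ∀ c : L2 Ω, Integrable (fun x => c x * ψ x) (area Ω) := fun c =>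
    (Lp.memLp c).integrable_mul m1
  have i2 : ∀ u : L2Vec Ω, Integrable (fun x => (inner ℝ (u x) (curlScalar ψ x) : ℝ)) (area Ω) := by
    intro u
    have := L2.integrable_inner (𝕜 := ℝ) u m2.toLp
    refine this.congr ?_
    filter_upwards [m2.coeFn_toLp] with x hx
    rw [hx]
  have e1 : ∫ x in Ω, (c - c') x * ψ x = ∫ x in Ω, (c x * ψ x - c' x * ψ x) := by
    refine integral_congr_ae ?_
    filter_upwards [Lp.coeFn_sub c c'] with x hx
    rw [hx, Pi.sub_apply, sub_mul]
  have e2 : ∫ x in Ω, (inner ℝ ((u - u') x) (curlScalar ψ x) : ℝ)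
      = ∫ x in Ω, (inner ℝ (u x) (curlScalar ψ x) - inner ℝ (u' x) (curlScalar ψ x) : ℝ) := by
    refine integral_congr_ae ?_
    filter_upwards [Lp.coeFn_sub u u'] with x hx
    rw [hx, Pi.sub_apply, inner_sub_left]
  rw [e1, e2, integral_sub (i1 c) (i1 c'), integral_sub (i2 u) (i2 u'), h ψ hψ hs, h' ψ hψ hs]

theorem eLpNorm_sub_lt_of_ae_eq {F : Type*} [NormedAddCommGroup F] {μ : Measure Plane} {δ : ℝ≥0∞}
    {f f' k : Plane → F} (hf : AEStronglyMeasurable f μ) (hf' : AEStronglyMeasurable f' μ)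
    (h : eLpNorm f 2 μ < δ / 2) (h' : eLpNorm f' 2 μ < δ / 2) (hk : k =ᵐ[μ] f - f') :
    eLpNorm k 2 μ < δ := by
  rw [eLpNorm_congr_ae hk]
  refine (eLpNorm_sub_le hf hf' (by norm_num)).trans_lt ?_
  calc _ < δ / 2 + δ / 2 := ENNReal.add_lt_add h h'
    _ = δ := ENNReal.add_halves δ

/-- Approximants to accuracy δ/2 are subtracted. With `IsHZeroCurl.sub` this gives the closure under
subtraction that puts time increments of E among the test fields. -/
theorem IsTangentialTrace.sub
    (hn : AEStronglyMeasurable n (arcLength Γ)) {u u' : L2Vec Ω} {c c' : L2 Ω} {g g' : L2Sheet Γ}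
    (h : IsTangentialTrace Ω Γ n u c g) (h' : IsTangentialTrace Ω Γ n u' c' g') :
    IsTangentialTrace Ω Γ n (u - u') (c - c') (g - g') := by
  intro δ hδ
  obtain ⟨φ, hφ, h1, h2, h3⟩ := h (δ / 2) (ENNReal.half_pos hδ.ne')
  obtain ⟨φ', hφ', h1', h2', h3'⟩ := h' (δ / 2) (ENNReal.half_pos hδ.ne')
  refine ⟨fun x => φ x - φ' x, hφ.sub hφ', ?_, ?_, ?_⟩
  · refine eLpNorm_sub_lt_of_ae_eq
      ((Lp.aestronglyMeasurable u).sub hφ.continuous.aestronglyMeasurable)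
      ((Lp.aestronglyMeasurable u').sub hφ'.continuous.aestronglyMeasurable) h1 h1' ?_
    filter_upwards [Lp.coeFn_sub u u'] with x hx
    simp only [hx, Pi.sub_apply]
    abel
  · refine eLpNorm_sub_lt_of_ae_eq
      ((Lp.aestronglyMeasurable c).sub (continuous_curlVector hφ).aestronglyMeasurable)
      ((Lp.aestronglyMeasurable c').sub (continuous_curlVector hφ').aestronglyMeasurable) h2 h2' ?_
    filter_upwards [Lp.coeFn_sub c c'] with x hx
    have hd : fderiv ℝ (fun x => φ x - φ' x) x = fderiv ℝ φ x - fderiv ℝ φ' x :=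
      fderiv_fun_sub (hφ.differentiable (by simp) x) (hφ'.differentiable (by simp) x)
    simp only [hx, Pi.sub_apply, curlVector, partialDeriv, hd, sub_apply,
      PiLp.sub_apply]
    ring
  · refine eLpNorm_sub_lt_of_ae_eq
      ((Lp.aestronglyMeasurable g).sub
        (aestronglyMeasurable_cross hφ.continuous.aestronglyMeasurable hn))
      ((Lp.aestronglyMeasurable g').sub
        (aestronglyMeasurable_cross hφ'.continuous.aestronglyMeasurable hn)) h3 h3' ?_
    filter_upwards [Lp.coeFn_sub g g'] with x hx
    simp only [hx, Pi.sub_apply, cross, PiLp.sub_apply]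
    ring

theorem IsSolution.isAbstractSolution {T ε₀ μ₀ τ₀ σ₀ : ℝ} {K K_t : ℝ → L2 Ω} {w : Unknowns Ω Γ}
    (hΓ : IsSheet Ω Γ n) (h : IsSolution Ω Γ n T ε₀ μ₀ τ₀ σ₀ K K_t w) :
    IsAbstractSolution {p : L2Vec Ω × L2 Ω × L2Sheet Γ | IsField Ω Γ n p.1 p.2.1 p.2.2}
      T ε₀ μ₀ τ₀ σ₀ w.E w.E_t w.E_tt w.curlE w.H w.H_t K K_t w.traceE
      (fun t => tangential hΓ (w.J t)) (fun t => tangential hΓ (w.J_t t)) where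
  sub_mem p hp q hq :=
    ⟨hp.hZeroCurl.sub hq.hZeroCurl, hp.trace.sub hΓ.measurable_normal hq.trace⟩
  deriv_E := h.deriv_E
  deriv_E_t := h.deriv_E_t
  deriv_H := h.deriv_H
  deriv_j := h.deriv_J.map (tangential hΓ)
  deriv_K := h.deriv_K
  mem := h.field_E
  continuous_c := h.continuous_curlE
  continuous_g := h.continuous_traceE
  electric := h.electric.mono fun t ht p hp => ht _ _ _ hp
  magnetic t ht := by
    refine ext_inner_right ℝ fun ψ => ?_
    rw [inner_smul_left, inner_sub_left, inner_neg_left, conj_trivial]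
    exact h.magnetic t ht ψ
  current t ht := by
    refine ext_inner_right ℝ fun g => ?_
    -- The law is tested only with tangential parts, which exhaust L²(Γ).
    obtain ⟨χ, rfl⟩ := tangential_surjective hΓ g
    rw [inner_smul_left, inner_add_left, inner_smul_left, conj_trivial, conj_trivial,
      inner_tangential_tangential, inner_tangential_tangential, real_inner_comm,
      inner_tangential]
    exact h.current t ht χ
  initial p hp := by
    rw [inner_tangential]
    exact h.initial _ _ _ hp

theorem energy_eq_abstractEnergy (hΓ : IsSheet Ω Γ n) (ε₀ μ₀ τ₀ σ₀ : ℝ) (w : Unknowns Ω Γ)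
    (t : ℝ) :
    energy n ε₀ μ₀ τ₀ σ₀ w t = abstractEnergy ε₀ μ₀ τ₀ σ₀ w.E w.E_t w.H w.H_t w.traceE
      (fun t => tangential hΓ (w.J t)) (fun t => tangential hΓ (w.J_t t)) t := by
  simp only [energy, abstractEnergy, norm_tangential_sq]

end Fields

end Graphene

theorem theorem2p1 (τ₀ : ℝ) (hτ₀ : 0 < τ₀) :
    ∃ C : ℝ, 0 < C ∧
      ∀ (Ω Γ : Set Graphene.Plane) (n : Graphene.Plane → Graphene.Plane) (T ε₀ μ₀ σ₀ : ℝ)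
        (K K_t : ℝ → Graphene.L2 Ω) (w : Graphene.Unknowns Ω Γ),
        Graphene.IsLipschitzPolygon Ω → Graphene.IsSheet Ω Γ n →
        0 < T → 0 < ε₀ → 0 < μ₀ → 0 < σ₀ →
        Graphene.IsSolution Ω Γ n T ε₀ μ₀ τ₀ σ₀ K K_t w →
        ∀ t ∈ Set.Icc 0 T,
          Graphene.energy n ε₀ μ₀ τ₀ σ₀ w t ≤
            (Graphene.energy n ε₀ μ₀ τ₀ σ₀ w 0
              + ∫ s in (0 : ℝ)..t,
                  (τ₀ / μ₀ * ‖K_t s‖ ^ 2 + 1 / (τ₀ * μ₀) * ‖K s‖ ^ 2))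
            * Real.exp (C * t) := by
  refine ⟨8 + 2 / τ₀, by positivity, ?_⟩
  intro Ω Γ n T ε₀ μ₀ σ₀ K K_t w _ hΓ hT hε hμ hσ h t ht
  rw [Graphene.energy_eq_abstractEnergy hΓ, Graphene.energy_eq_abstractEnergy hΓ]
  exact (h.isAbstractSolution hΓ).energy_le hT hε hμ hτ₀ hσ ht
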